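/- Let $m\ge 1$ be an integer and let $G$ be a finite simple graph with vertex connectivity $\kappa(G)\ge 2m+1$ and sun toughness $s(G)\ge \frac{m+1}{m+2}$. Then $G$ is a $(P_{\ge 3},m)$-factor deleted graph: for every set $E'\subseteq E(G)$ with $|E'|=m$, the graph $G-E'$ has a $P_{\ge 3}$-factor, that is, a spanning subgraph each of whose components is a path with at least three vertices. Here $\kappa(G)=|V(G)|-1$ if $G$ is complete, and otherwise $\kappa(G)$ is the minimum size of a set $X\subseteq V(G)$ such that $G-X$ is disconnected. A graph $H$ is factor-critical if $H-v$ has a perfect matching for every $v\in V(H)$. A sun is a graph isomorphic to $K_1$, to $K_2$, or to a graph obtained from a factor-critical graph $H$ with vertices $v_1,\dots,v_n$ by adding new vertices $u_1,\dots,u_n$ and the edges $v_iu_i$ $(1\le i\le n)$. Let $sun(G)$ be the number of components of $G$ that are suns. The sun toughness is $s(G)=+\infty$ if $G$ is complete, and otherwise $$s(G)=\min\left\{\frac{|X|}{sun(G-X)} : X\subseteq V(G),\ sun(G-X)\ge 2\right\}.$$ -/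

import Mathlib

open scoped ENNReal

namespace PathFactor

universe u

/-- `G - X`: the graph obtained from `G` by deleting the vertices of `X`. -/
abbrev deleteVerts {V : Type u} (G : SimpleGraph V) (X : Set V) :
    SimpleGraph (Xᶜ : Set V) :=
  G.induce Xᶜ

/-- `H` is a `P_{≥ k}`-factor of `G`: a spanning subgraph every component of which is
isomorphic to a path of order at least `k` (`SimpleGraph.pathGraph n` has `n` vertices). -/
def IsPathFactor {V : Type u} (k : ℕ) (G H : SimpleGraph V) : Prop :=
  H ≤ G ∧ ∀ c : H.ConnectedComponent,
    ∃ n : ℕ, k ≤ n ∧ Nonempty (c.toSimpleGraph ≃g SimpleGraph.pathGraph n)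

/-- `G` has a `P_{≥ k}`-factor. -/
def HasPathFactor {V : Type u} (k : ℕ) (G : SimpleGraph V) : Prop :=
  ∃ H : SimpleGraph V, IsPathFactor k G H

/-- `G` is a `(P_{≥ k}, m)`-factor deleted graph. -/
def IsPathFactorDeleted {V : Type u} (k m : ℕ) (G : SimpleGraph V) : Prop :=
  ∀ E' : Set (Sym2 V), E' ⊆ G.edgeSet → E'.ncard = m → HasPathFactor k (G.deleteEdges E')

/-- `H` is factor-critical: `H - v` has a 1-factor for every vertex `v`. -/
def IsFactorCritical {V : Type u} (H : SimpleGraph V) : Prop :=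
  ∀ v : V, ∃ M : (deleteVerts H {v}).Subgraph, M.IsPerfectMatching

/-- The graph obtained from `H` by adding, for every vertex `v` (here `Sum.inl v`), one new
vertex (here `Sum.inr v`) and one new edge joining it to `v`. -/
def addPendants {V : Type u} (H : SimpleGraph V) : SimpleGraph (V ⊕ V) where
  Adj
    | Sum.inl v, Sum.inl w => H.Adj v w
    | Sum.inl v, Sum.inr w => v = w
    | Sum.inr v, Sum.inl w => v = w
    | Sum.inr _, Sum.inr _ => False
  symm := ⟨by
    rintro (v | v) (w | w) h
    · exact SimpleGraph.Adj.symm h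
    · exact Eq.symm h
    · exact Eq.symm h
    · exact h⟩
  loopless := ⟨by
    rintro (v | v) h
    · exact H.irrefl h
    · exact h⟩

/-- A (finite) graph is a sun if it is isomorphic to `K₁`, to `K₂`, or to the graph obtained
from a factor-critical graph by attaching one pendant vertex to each of its vertices. -/
def IsSun {W : Type u} (S : SimpleGraph W) : Prop :=
  Nonempty (S ≃g SimpleGraph.completeGraph (Fin 1)) ∨
  Nonempty (S ≃g SimpleGraph.completeGraph (Fin 2)) ∨
  ∃ (n : ℕ) (H : SimpleGraph (Fin n)), IsFactorCritical H ∧ Nonempty (S ≃g addPendants H)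

/-- `sun(G)`: the number of components of `G` that are suns. -/
noncomputable def sunNumber {V : Type u} (G : SimpleGraph V) : ℕ :=
  {c : G.ConnectedComponent | IsSun c.toSimpleGraph}.ncard

open Classical in
/-- The sun toughness `s(G)`: it is `+∞` if `G` is complete, and otherwise the minimum of
`|X| / sun(G - X)` over all vertex sets `X` with `sun(G - X) ≥ 2`. -/
noncomputable def sunToughness {V : Type u} (G : SimpleGraph V) : ℝ≥0∞ :=
  if G = ⊤ then ⊤
  else sInf {r : ℝ≥0∞ | ∃ X : Set V, 2 ≤ sunNumber (deleteVerts G X) ∧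
    r = (X.ncard : ℝ≥0∞) / (sunNumber (deleteVerts G X) : ℝ≥0∞)}

/-- `X` is a vertex cut of `G`: the graph `G - X` is disconnected, that is, it has two vertices
that no walk joins. -/
def IsVertexCut {V : Type u} (G : SimpleGraph V) (X : Set V) : Prop :=
  ¬ (deleteVerts G X).Preconnected

open Classical in
/-- The (vertex) connectivity `κ(G)` of a finite graph: it is `|V(G)| - 1` if `G` is complete,
and otherwise the least size of a vertex cut of `G`. -/
noncomputable def connectivity {V : Type u} (G : SimpleGraph V) : ℕ :=
  if G = ⊤ then Nat.card V - 1
  else sInf {k : ℕ | ∃ X : Set V, IsVertexCut G X ∧ X.ncard = k}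

end PathFactor

/-! The engine is the sufficiency half of Kaneko's theorem: if every set `X` leaves at most `2|X|`
sun components, there is a cover by disjoint paths of order at least three (`SunBound.pathCover`).
The rest verifies this bound for `G - E'` (`sunBound_deleteEdges`). Suppose `X` violates it. Each
sun has a vertex with at most one neighbour inside the sun, while degrees in `G` are at least `2m +
1`; so every sun component contains a vertex meeting at least `2m - |X|` edges of `E'`. This
excludes `|X| < m`, and for `|X| = m` every deleted edge would have an end in each of three suns. If
`m < |X| ≤ 2m`, then `G - X` is connected, and each deleted edge creates at most two suns, too few
altogether. If `|X| ≥ 2m + 1`, toughness bounds the suns of `G - X`, and arithmetic finishes.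

Kaneko's theorem goes by induction on vertices plus edges. Any vertex of a sun is an end of a path
whose removal leaves a coverable set (`IsSunSet.hanging`). So if `X` is tight, Hall's theorem lets
each vertex of `X` link two suns, and induction covers the other components (`pathCover_of_tight`).
What survives is a connected non-sun whose bound is strict for every nonempty `X`. Deleting an edge
then either keeps the bound or produces suns of very restricted shape; this forces every vertex of
degree at least two to have a pendant neighbour (`IsMinimalCounterexample.exists_pendant`). The
graph is then a core `W` with one pendant at each vertex. A perfect matching of `W` yields a cover
by four-vertex paths. Without one, a sharpened Tutte theorem (`hasMatching_or_exists_lt_critical`)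
gives `X ⊆ W` with more than `|X|` factor-critical components; with their pendants these are suns,
and the pendants of `X` are `|X|` more, against the bound.

Components are vertex sets of the ambient graph, so that different edge sets and vertex subsets can
be compared directly. `K₂` is the corona of a single vertex, the empty matching making it
factor-critical. -/

namespace PathFactor

/-! ### Components as vertex sets. -/

section Components

variable {V : Type*}

/-- `C` is (the vertex set of) a component of the subgraph of `G` induced by `U`: a minimal
nonempty subset of `U` closed under adjacency within `U`. -/
structure IsComp (G : SimpleGraph V) (U C : Set V) : Prop where
  nonempty : C.Nonempty
  subset : C ⊆ U
  closed : ∀ x ∈ C, ∀ y ∈ U, G.Adj x y → y ∈ C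
  minimal : ∀ S ⊆ C, S.Nonempty → (∀ x ∈ S, ∀ y ∈ U, G.Adj x y → y ∈ S) → S = C

variable {G G' : SimpleGraph V} {U U' C D S : Set V} {x : V}

theorem IsComp.subset_of_closed (hC : IsComp G U C)
    (hS : ∀ x ∈ S, ∀ y ∈ U, G.Adj x y → y ∈ S) (hxC : x ∈ C) (hxS : x ∈ S) : C ⊆ S := by
  have h := hC.minimal (C ∩ S) Set.inter_subset_left ⟨x, hxC, hxS⟩
    fun y hy z hz hyz => ⟨hC.closed y hy.1 z hz hyz, hS y hy.2 z hz hyz⟩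
  exact Set.inter_eq_left.mp h

theorem IsComp.eq_of_mem (hC : IsComp G U C) (hD : IsComp G U D) (hxC : x ∈ C) (hxD : x ∈ D) :
    C = D :=
  (hC.subset_of_closed hD.closed hxC hxD).antisymm (hD.subset_of_closed hC.closed hxD hxC)

theorem IsComp.disjoint (hC : IsComp G U C) (hD : IsComp G U D) (h : C ≠ D) : Disjoint C D :=
  Set.disjoint_left.mpr fun _ hxC hxD => h (hC.eq_of_mem hD hxC hxD)

theorem exists_isComp_mem (G : SimpleGraph V) (hx : x ∈ U) : ∃ C, IsComp G U C ∧ x ∈ C := by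
  let F : Set (Set V) := {S | S ⊆ U ∧ x ∈ S ∧ ∀ y ∈ S, ∀ z ∈ U, G.Adj y z → z ∈ S}
  have hU : U ∈ F := ⟨subset_rfl, hx, fun _ _ z hz _ => hz⟩
  have hF : ∀ y ∈ ⋂₀ F, ∀ z ∈ U, G.Adj y z → z ∈ ⋂₀ F :=
    fun y hy z hz hyz S hS => hS.2.2 y (hy S hS) z hz hyz
  have hxF : x ∈ ⋂₀ F := fun S hS => hS.2.1
  refine ⟨⋂₀ F, ⟨⟨x, hxF⟩, Set.sInter_subset_of_mem hU, hF, ?_⟩, hxF⟩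
  intro S hSF hne hS
  refine hSF.antisymm ?_
  by_cases hxS : x ∈ S
  · exact Set.sInter_subset_of_mem ⟨hSF.trans (Set.sInter_subset_of_mem hU), hxS, hS⟩
  · obtain ⟨s, hs⟩ := hne
    -- Adjacency is symmetric, so removing a closed set leaves a closed set; it still contains `x`,
    -- hence would contain the whole intersection.
    have hmem : ⋂₀ F \ S ∈ F := by
      refine ⟨Set.sdiff_subset.trans (Set.sInter_subset_of_mem hU), ⟨hxF, hxS⟩, ?_⟩
      intro y hy z hz hyz
      refine ⟨hF y hy.1 z hz hyz, fun hzS => hy.2 ?_⟩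
      exact hS z hzS y (Set.sInter_subset_of_mem hU hy.1) hyz.symm
    exact absurd hs (Set.sInter_subset_of_mem hmem (hSF hs)).2

/-- A component depends only on the edges inside it and on the absence of edges leaving it. -/
theorem IsComp.congr (hC : IsComp G U C) (hCU : C ⊆ U')
    (hout : ∀ x ∈ C, ∀ y ∈ U', G'.Adj x y → y ∈ U ∧ G.Adj x y)
    (hin : ∀ x ∈ C, ∀ y ∈ C, G.Adj x y → G'.Adj x y) : IsComp G' U' C where
  nonempty := hC.nonempty
  subset := hCU
  closed x hx y hy hxy := hC.closed x hx y (hout x hx y hy hxy).1 (hout x hx y hy hxy).2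
  minimal S hSC hne hS := hC.minimal S hSC hne fun x hx y hy hxy =>
    have hyC := hC.closed x (hSC hx) y hy hxy
    hS x hx y (hCU hyC) (hin x (hSC hx) y hyC hxy)

/-- The components of a union of components are components. -/
theorem IsComp.of_closed (hC : IsComp G S C) (hSU : S ⊆ U)
    (hS : ∀ x ∈ S, ∀ y ∈ U, G.Adj x y → y ∈ S) : IsComp G U C :=
  hC.congr (hC.subset.trans hSU) (fun x hx y hy h => ⟨hS x (hC.subset hx) y hy h, h⟩)
    fun _ _ _ _ h => h

theorem IsComp.mono (hC : IsComp G U C) (hCU : C ⊆ U') (hU : U' ⊆ U) : IsComp G U' C :=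
  hC.congr hCU (fun _ _ _ hy h => ⟨hU hy, h⟩) fun _ _ _ _ h => h

theorem sUnion_isComp (G : SimpleGraph V) (U : Set V) : ⋃₀ {C | IsComp G U C} = U := by
  ext x
  constructor
  · rintro ⟨C, hC, hx⟩
    exact hC.subset hx
  · intro hx
    obtain ⟨C, hC, hxC⟩ := exists_isComp_mem G hx
    exact ⟨C, hC, hxC⟩

theorem isComp_singleton (hx : x ∈ U) (h : ∀ y ∈ U, ¬ G.Adj x y) : IsComp G U {x} where
  nonempty := ⟨x, rfl⟩
  subset := by simpa using hx
  closed y hy z hz hyz := absurd (by rw [Set.mem_singleton_iff] at hy; exact hy ▸ hyz) (h z hz)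
  minimal S hS hne _ := (Set.subset_singleton_iff_eq.mp hS).resolve_left hne.ne_empty

/-- The components of an induced subgraph, seen as sets of vertices of the ambient graph. -/
theorem isComp_range_iff {W : Type*} {H : SimpleGraph W} (φ : H ↪g G) :
    IsComp G (Set.range φ) C ↔ ∃ c : H.ConnectedComponent, C = φ '' c.supp := by
  have key : ∀ c : H.ConnectedComponent, IsComp G (Set.range φ) (φ '' c.supp) := by
    intro c
    refine ⟨?_, Set.image_subset_range _ _, ?_, ?_⟩
    · induction c using SimpleGraph.ConnectedComponent.ind with
      | h v => exact ⟨φ v, v, rfl, rfl⟩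
    · rintro _ ⟨a, ha, rfl⟩ _ ⟨b, rfl⟩ hab
      refine ⟨b, ?_, rfl⟩
      have : H.Adj a b := φ.map_adj_iff.mp hab
      rw [SimpleGraph.ConnectedComponent.mem_supp_iff] at ha ⊢
      rw [← ha]
      exact SimpleGraph.ConnectedComponent.sound this.symm.reachable
    · rintro S hSC ⟨s, hs⟩ hS
      refine hSC.antisymm ?_
      obtain ⟨a, ha, rfl⟩ := hSC hs
      rintro _ ⟨b, hb, rfl⟩
      have hr : H.Reachable a b := by
        rw [SimpleGraph.ConnectedComponent.mem_supp_iff] at ha hb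
        exact SimpleGraph.ConnectedComponent.exact (ha.trans hb.symm)
      obtain ⟨p⟩ := hr
      clear hb ha
      induction p with
      | nil => exact hs
      | cons h p ih => exact ih (hS _ hs _ ⟨_, rfl⟩ (φ.map_adj_iff.mpr h))
  constructor
  · intro hC
    obtain ⟨x, hx⟩ := hC.nonempty
    obtain ⟨a, rfl⟩ := hC.subset hx
    exact ⟨H.connectedComponentMk a, hC.eq_of_mem (key _) hx ⟨a, rfl, rfl⟩⟩
  · rintro ⟨c, rfl⟩
    exact key c

theorem image_supp_injective {W : Type*} {H : SimpleGraph W} (φ : H ↪g G) :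
    Function.Injective fun c : H.ConnectedComponent => φ '' c.supp := fun _ _ h =>
  SimpleGraph.ConnectedComponent.supp_injective (φ.injective.image_injective h)

end Components

/-! ### Path covers, and sets hanging at an entry vertex. -/

section Packings

variable {V : Type*}

/-- The vertex set `S` is partitioned into vertex sets of paths of `G` of order at least three. -/
inductive PathCover (G : SimpleGraph V) : Set V → Prop
  | empty : PathCover G ∅
  | cons (l : List V) (S : Set V) : l.Nodup → l.IsChain G.Adj → 3 ≤ l.length →
      Disjoint {x | x ∈ l} S → PathCover G S → PathCover G ({x | x ∈ l} ∪ S)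

/-- `C` is partitioned into the vertex set of a path of order at least `n` starting at `p`
and the vertex sets of paths of order at least three. -/
def Hanging (G : SimpleGraph V) (n : ℕ) (C : Set V) (p : V) : Prop :=
  ∃ (l : List V) (S : Set V), (p :: l).Nodup ∧ (p :: l).IsChain G.Adj ∧ n ≤ l.length + 1 ∧
    Disjoint {x | x ∈ p :: l} S ∧ PathCover G S ∧ C = {x | x ∈ p :: l} ∪ S

variable {G G' : SimpleGraph V} {C D S T : Set V} {p q x : V} {n m : ℕ}

theorem PathCover.mono (h : PathCover G S) (hG : G ≤ G') : PathCover G' S := by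
  induction h with
  | empty => exact .empty
  | cons l S hl hc h3 hd _ ih => exact .cons l S hl (hc.imp fun _ _ h => hG h) h3 hd ih

theorem PathCover.union (hS : PathCover G S) (hT : PathCover G T) (hd : Disjoint S T) :
    PathCover G (S ∪ T) := by
  induction hS with
  | empty => simpa using hT
  | cons l S hl hc h3 hdl _ ih =>
    rw [Set.disjoint_union_left] at hd
    rw [Set.union_assoc]
    exact .cons l _ hl hc h3 (Set.disjoint_union_right.mpr ⟨hdl, hd.1⟩) (ih hd.2)

theorem PathCover.biUnion {ι : Type*} (s : Finset ι) (f : ι → Set V)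
    (hf : ∀ i ∈ s, PathCover G (f i))
    (hd : ∀ i ∈ s, ∀ j ∈ s, i ≠ j → Disjoint (f i) (f j)) : PathCover G (⋃ i ∈ s, f i) := by
  classical
  induction s using Finset.induction_on with
  | empty => simpa using PathCover.empty
  | insert a s ha ih =>
    rw [Finset.set_biUnion_insert]
    refine (hf a (by simp)).union (ih (fun i hi => hf i (by simp [hi]))
      fun i hi j hj => hd i (by simp [hi]) j (by simp [hj])) ?_
    rw [Set.disjoint_iUnion₂_right]
    intro i hi
    exact hd a (by simp) i (by simp [hi]) (by rintro rfl; exact ha hi)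

theorem PathCover.sUnion [Finite V] (F : Set (Set V)) (hF : ∀ C ∈ F, PathCover G C)
    (hd : ∀ C ∈ F, ∀ D ∈ F, C ≠ D → Disjoint C D) : PathCover G (⋃₀ F) := by
  have := PathCover.biUnion (G := G) F.toFinite.toFinset id (by simpa using hF)
    (by simpa using hd)
  simpa [Set.sUnion_eq_biUnion] using this

theorem Hanging.mono (h : Hanging G n C p) (hG : G ≤ G') : Hanging G' n C p := by
  obtain ⟨l, S, hl, hc, hn, hd, hS, rfl⟩ := h
  exact ⟨l, S, hl, hc.imp fun _ _ h => hG h, hn, hd, hS.mono hG, rfl⟩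

theorem Hanging.weaken (h : Hanging G n C p) (hm : m ≤ n) : Hanging G m C p := by
  obtain ⟨l, S, hl, hc, hn, hd, hS, rfl⟩ := h
  exact ⟨l, S, hl, hc, hm.trans hn, hd, hS, rfl⟩

theorem hanging_singleton (G : SimpleGraph V) (p : V) : Hanging G 1 {p} p :=
  ⟨[], ∅, by simp, by simp, by simp, by simp, .empty, by simp⟩

theorem Hanging.cons (h : Hanging G n C p) (hx : x ∉ C) (hxp : G.Adj x p) :
    Hanging G (n + 1) (insert x C) x := by
  obtain ⟨l, S, hl, hc, hn, hd, hS, rfl⟩ := h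
  rw [Set.mem_union, not_or] at hx
  refine ⟨p :: l, S, List.nodup_cons.mpr ⟨hx.1, hl⟩, List.isChain_cons_cons.mpr ⟨hxp, hc⟩,
    by simpa using hn, ?_, hS, ?_⟩
  · rw [Set.disjoint_left] at hd ⊢
    intro y hy
    rcases List.mem_cons.mp hy with rfl | hy
    · exact hx.2
    · exact hd hy
  · ext y
    simp [or_assoc]

theorem Hanging.union (h : Hanging G n C p) (hD : PathCover G D) (hd : Disjoint C D) :
    Hanging G n (C ∪ D) p := by
  obtain ⟨l, S, hl, hc, hn, hdl, hS, rfl⟩ := h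
  rw [Set.disjoint_union_left] at hd
  exact ⟨l, S ∪ D, hl, hc, hn, Set.disjoint_union_right.mpr ⟨hdl, hd.1⟩, hS.union hD hd.2,
    by rw [Set.union_assoc]⟩

theorem Hanging.pathCover (h : Hanging G n C p) (hn : 3 ≤ n) : PathCover G C := by
  obtain ⟨l, S, hl, hc, hn', hd, hS, rfl⟩ := h
  exact .cons _ S hl hc (by simpa using hn.trans hn') hd hS

/-- Reversing the first path puts `p` next to `q`. Only the total order counts, so a single vertex
may be joined to a pair. -/
theorem Hanging.join (h : Hanging G n C p) (h' : Hanging G m D q) (hd : Disjoint C D)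
    (hpq : G.Adj p q) (hnm : 3 ≤ n + m) : PathCover G (C ∪ D) := by
  obtain ⟨l, S, hl, hc, hn, hdl, hS, rfl⟩ := h
  obtain ⟨l', S', hl', hc', hm, hdl', hS', rfl⟩ := h'
  rw [Set.disjoint_union_left, Set.disjoint_union_right, Set.disjoint_union_right] at hd
  have h1 : {x | x ∈ p :: l} ∪ S ∪ ({x | x ∈ q :: l'} ∪ S') =
      {x | x ∈ (p :: l).reverse ++ (q :: l')} ∪ (S ∪ S') := by
    ext y
    simp only [Set.mem_union, Set.mem_ofPred_eq, List.mem_append, List.mem_reverse]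
    tauto
  rw [h1]
  refine .cons _ _ ?_ ?_ ?_ ?_ (hS.union hS' hd.2.2)
  · refine List.Nodup.append (List.nodup_reverse.mpr hl) hl' ?_
    intro y hy hy'
    exact Set.disjoint_left.mp hd.1.1 (List.mem_reverse.mp hy) hy'
  · rw [List.isChain_append]
    refine ⟨?_, hc', ?_⟩
    · rw [List.isChain_reverse]
      exact hc.imp fun _ _ h => h.symm
    · intro y hy z hz
      simp at hy hz
      subst hy hz
      exact hpq
  · simp only [List.length_append, List.length_reverse, List.length_cons]
    omega
  · rw [Set.disjoint_left]
    intro y hy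
    rcases List.mem_append.mp hy with hy | hy
    · have hy := List.mem_reverse.mp hy
      rintro (h | h)
      · exact Set.disjoint_left.mp hdl hy h
      · exact Set.disjoint_left.mp hd.1.2 hy h
    · rintro (h | h)
      · exact Set.disjoint_left.mp hd.2.1 h hy
      · exact Set.disjoint_left.mp hdl' hy h

/-- A vertex joined to two hanging sets links them. -/
theorem Hanging.link (h : Hanging G 1 C p) (h' : Hanging G 1 D q) (hd : Disjoint C D)
    (hxC : x ∉ C) (hxD : x ∉ D) (hxp : G.Adj x p) (hxq : G.Adj x q) :
    PathCover G (insert x (C ∪ D)) := by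
  have := (h.cons hxC hxp).join h' (by simp [hd, hxD]) hxq (by norm_num)
  rwa [Set.insert_union] at this

end Packings

/-! ### Path covers and entry vertices of suns. -/

section Coronas

variable {V : Type*}

/-- The subgraph of `G` induced by `S` has a perfect matching, given as an involution. -/
def HasMatching (G : SimpleGraph V) (S : Set V) : Prop :=
  ∃ g : V → V, ∀ v ∈ S, g v ∈ S ∧ G.Adj v (g v) ∧ g (g v) = v

/-- `f` attaches to the vertices of `K` distinct neighbours outside `K`. -/
structure IsPendantMap (G : SimpleGraph V) (K : Set V) (f : V → V) : Prop where
  inj : Set.InjOn f K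
  notMem : ∀ k ∈ K, f k ∉ K
  adj : ∀ k ∈ K, G.Adj k (f k)

/-- `C` induces the graph obtained from the factor-critical graph induced by `K` by attaching
to every `k ∈ K` the pendant vertex `f k`. -/
structure IsCorona (G : SimpleGraph V) (C K : Set V) (f : V → V) : Prop where
  nonempty : K.Nonempty
  eq : C = K ∪ f '' K
  pendant : IsPendantMap G K f
  leaf : ∀ k ∈ K, ∀ y ∈ C, G.Adj (f k) y → y = k
  critical : ∀ k ∈ K, HasMatching G (K \ {k})

/-- `C` induces a sun. -/
def IsSunSet (G : SimpleGraph V) (C : Set V) : Prop :=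
  (∃ v, C = {v}) ∨ ∃ K f, IsCorona G C K f

variable {G G' : SimpleGraph V} {A B C K L S : Set V} {f : V → V} {a i j p w : V} {n : ℕ}

theorem HasMatching.congr (h : HasMatching G S)
    (hG : ∀ x ∈ S, ∀ y ∈ S, G.Adj x y → G'.Adj x y) : HasMatching G' S := by
  obtain ⟨g, hg⟩ := h
  exact ⟨g, fun v hv => ⟨(hg v hv).1, hG _ hv _ (hg v hv).1 (hg v hv).2.1, (hg v hv).2.2⟩⟩

theorem IsPendantMap.subset (h : IsPendantMap G K f) (hL : L ⊆ K) : IsPendantMap G L f where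
  inj := h.inj.mono hL
  notMem k hk hfk := h.notMem k (hL hk) (hL hfk)
  adj k hk := h.adj k (hL hk)

theorem IsPendantMap.ne (h : IsPendantMap G K f) (hi : i ∈ K) (hj : j ∈ K) : f i ≠ j := by
  rintro rfl
  exact h.notMem i hi hj

theorem IsPendantMap.disjoint (h : IsPendantMap G K f) (hL : L ⊆ K) (hS : S ⊆ K)
    (hLS : Disjoint L S) : Disjoint (L ∪ f '' L) (S ∪ f '' S) := by
  rw [Set.disjoint_left] at hLS ⊢
  rintro x (hx | ⟨y, hy, rfl⟩) (hx' | ⟨z, hz, hzx⟩)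
  · exact hLS hx hx'
  · exact h.ne (hS hz) (hL hx) hzx
  · exact h.ne (hL hy) (hS hx') rfl
  · exact hLS hy (h.inj (hS hz) (hL hy) hzx ▸ hz)

theorem span_union (f : V → V) (L S : Set V) :
    (L ∪ S) ∪ f '' (L ∪ S) = (L ∪ f '' L) ∪ (S ∪ f '' S) := by
  rw [Set.image_union, Set.union_union_union_comm]

theorem span_erase (f : V → V) (hi : i ∈ K) :
    K ∪ f '' K = {i, f i} ∪ (K \ {i} ∪ f '' (K \ {i})) := by
  conv_lhs => rw [← Set.union_sdiff_cancel (Set.singleton_subset_iff.mpr hi), span_union]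
  rw [Set.image_singleton]
  rfl

theorem IsPendantMap.disjoint_erase (h : IsPendantMap G K f) (hi : i ∈ K) :
    Disjoint {i, f i} (K \ {i} ∪ f '' (K \ {i})) := by
  have := h.disjoint (Set.singleton_subset_iff.mpr hi) Set.sdiff_subset
    (Set.disjoint_sdiff_right (s := {i}) (t := K))
  rwa [Set.image_singleton] at this

theorem IsPendantMap.hanging_pair (h : IsPendantMap G K f) (hi : i ∈ K) (hp : p = i ∨ p = f i) :
    Hanging G 2 {i, f i} p := by
  have hadj := h.adj i hi
  rcases hp with rfl | rfl
  · have := (hanging_singleton G (f p)).cons (x := p) (by simpa using hadj.ne) hadj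
    exact this
  · have := (hanging_singleton G i).cons (x := f i) (by simpa using hadj.ne') hadj.symm
    rwa [Set.pair_comm] at this

/-- The path is `i`, `g i`, `f (g i)`. Leaving out `f i` keeps `i` free as an end, to be prolonged
by `f i` or by another neighbour. -/
theorem IsPendantMap.hanging_of_pathCover (h : IsPendantMap G K f) {g : V → V}
    (hg : ∀ v ∈ K, g v ∈ K ∧ G.Adj v (g v) ∧ g (g v) = v) (hi : i ∈ K)
    (hP : PathCover G (K \ {i, g i} ∪ f '' (K \ {i, g i}))) :
    Hanging G 3 ((K ∪ f '' K) \ {f i}) i := by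
  obtain ⟨hgK, hig, -⟩ := hg i hi
  have hd := h.disjoint (L := {i, g i}) (S := K \ {i, g i})
    (by rintro x (rfl | rfl) <;> assumption) Set.sdiff_subset Set.disjoint_sdiff_right
  have h1 := h.hanging_pair hgK (Or.inl rfl)
  have h2 := h1.cons (x := i) (by
    rintro (h' | h')
    · exact hig.ne h'
    · exact h.ne hgK hi h'.symm) hig
  have h3 := h2.union hP (hd.mono_left (by
    rintro x (rfl | rfl | rfl)
    · simp
    · simp
    · exact Or.inr ⟨g i, by simp, rfl⟩))
  convert h3 using 1
  have h4 : K = {i, g i} ∪ K \ {i, g i} :=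
    (Set.union_sdiff_cancel (by rintro x (rfl | rfl) <;> assumption)).symm
  conv_lhs => rw [h4, span_union, Set.union_sdiff_distrib]
  congr 1
  · rw [Set.image_pair]
    ext x
    have e1 : i ≠ f i := (h.ne hi hi).symm
    have e2 : g i ≠ f i := (h.ne hi hgK).symm
    have e3 : f (g i) ≠ f i := fun e => hig.ne (h.inj hgK hi e).symm
    simp only [Set.mem_sdiff, Set.mem_union, Set.mem_insert_iff, Set.mem_singleton_iff]
    constructor
    · rintro ⟨(h | h) | h | h, hx⟩
      exacts [Or.inl h, Or.inr (Or.inl h), absurd h hx, Or.inr (Or.inr h)]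
    · rintro (rfl | rfl | rfl)
      exacts [⟨Or.inl (Or.inl rfl), e1⟩, ⟨Or.inl (Or.inr rfl), e2⟩, ⟨Or.inr (Or.inr rfl), e3⟩]
  · refine Set.sdiff_singleton_eq_self fun hfi => ?_
    exact Set.disjoint_left.mp hd (Or.inr ⟨i, by simp, rfl⟩) hfi

theorem IsPendantMap.insert_sdiff (h : IsPendantMap G K f) (hi : i ∈ K)
    (hH : Hanging G n ((K ∪ f '' K) \ {f i}) i) : Hanging G (n + 1) (K ∪ f '' K) (f i) := by
  have := hH.cons (x := f i) (by simp) (h.adj i hi).symm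
  have hmem : f i ∈ K ∪ f '' K := Or.inr ⟨i, hi, rfl⟩
  rwa [Set.insert_sdiff_singleton, Set.insert_eq_of_mem hmem] at this

/-- Each matching edge carries the path `f i`, `i`, `g i`, `f (g i)`; the induction strips one
matching edge at a time. -/
theorem IsPendantMap.pathCover [Finite V] (h : IsPendantMap G K f) (hK : HasMatching G K) :
    PathCover G (K ∪ f '' K) := by
  obtain ⟨g, hg⟩ := hK
  induction hn : K.ncard using Nat.strong_induction_on generalizing K with
  | _ n ih =>
    rcases K.eq_empty_or_nonempty with rfl | ⟨i, hi⟩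
    · simpa using PathCover.empty
    · refine (h.insert_sdiff hi (h.hanging_of_pathCover hg hi ?_)).pathCover (by norm_num)
      refine ih _ ?_ (h.subset Set.sdiff_subset) ?_ rfl
      · rw [← hn]
        exact Set.ncard_lt_ncard ⟨Set.sdiff_subset, fun hs => (hs hi).2 (by simp)⟩
      · rintro v ⟨hv, hvi⟩
        obtain ⟨h1, h2, h3⟩ := hg v hv
        refine ⟨⟨h1, ?_⟩, h2, h3⟩
        rintro (h4 | h4)
        · exact hvi (by rw [← h3, h4]; simp)
        · have h4 : g v = g i := h4
          exact hvi (by rw [← h3, h4, (hg i hi).2.2]; simp)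

theorem IsPendantMap.hanging [Finite V] (h : IsPendantMap G K f) (hK : HasMatching G K)
    (hi : i ∈ K) : Hanging G 3 ((K ∪ f '' K) \ {f i}) i := by
  obtain ⟨g, hg⟩ := hK
  refine h.hanging_of_pathCover hg hi ((h.subset Set.sdiff_subset).pathCover ⟨g, ?_⟩)
  rintro v ⟨hv, hvi⟩
  obtain ⟨h1, h2, h3⟩ := hg v hv
  refine ⟨⟨h1, ?_⟩, h2, h3⟩
  rintro (h4 | h4)
  · exact hvi (by rw [← h3, h4]; simp)
  · have h4 : g v = g i := h4
    exact hvi (by rw [← h3, h4, (hg i hi).2.2]; simp)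

theorem IsCorona.pathCover_erase [Finite V] (h : IsCorona G C K f) (hi : i ∈ K) :
    PathCover G (K \ {i} ∪ f '' (K \ {i})) :=
  (h.pendant.subset Set.sdiff_subset).pathCover (h.critical i hi)

theorem IsCorona.mem_iff (h : IsCorona G C K f) : p ∈ C ↔ ∃ i ∈ K, p = i ∨ p = f i := by
  rw [h.eq]
  constructor
  · rintro (hp | ⟨i, hi, rfl⟩)
    · exact ⟨p, hp, Or.inl rfl⟩
    · exact ⟨i, hi, Or.inr rfl⟩
  · rintro ⟨i, hi, rfl | rfl⟩
    · exact Or.inl hi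
    · exact Or.inr ⟨i, hi, rfl⟩

theorem IsCorona.subset (h : IsCorona G C K f) : K ⊆ C := fun k hk =>
  h.mem_iff.mpr ⟨k, hk, Or.inl rfl⟩

theorem IsCorona.map_mem (h : IsCorona G C K f) (hi : i ∈ K) : f i ∈ C :=
  h.mem_iff.mpr ⟨i, hi, Or.inr rfl⟩

theorem IsCorona.congr (h : IsCorona G C K f)
    (hG : ∀ x ∈ C, ∀ y ∈ C, (G.Adj x y ↔ G'.Adj x y)) : IsCorona G' C K f where
  nonempty := h.nonempty
  eq := h.eq
  pendant := ⟨h.pendant.inj, h.pendant.notMem, fun k hk =>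
    (hG _ (h.subset hk) _ (h.map_mem hk)).mp (h.pendant.adj k hk)⟩
  leaf k hk y hy hky := h.leaf k hk y hy ((hG _ (h.map_mem hk) _ hy).mpr hky)
  critical k hk := (h.critical k hk).congr fun x hx y hy =>
    (hG x (h.subset hx.1) y (h.subset hy.1)).mp

theorem IsSunSet.congr (h : IsSunSet G C)
    (hG : ∀ x ∈ C, ∀ y ∈ C, (G.Adj x y ↔ G'.Adj x y)) : IsSunSet G' C := by
  rcases h with h | ⟨K, f, h⟩
  · exact Or.inl h
  · exact Or.inr ⟨K, f, h.congr hG⟩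

theorem IsCorona.eq_pair_union (h : IsCorona G C K f) (hi : i ∈ K) :
    C = {i, f i} ∪ (K \ {i} ∪ f '' (K \ {i})) := by
  rw [h.eq, span_erase f hi]

/-- The pair `i`, `f i` containing `p` is the path, and factor-criticality supplies a matching of `K
\ {i}` that covers everything else. -/
theorem IsCorona.hanging [Finite V] (h : IsCorona G C K f) (hp : p ∈ C) : Hanging G 2 C p := by
  obtain ⟨i, hi, hpi⟩ := h.mem_iff.mp hp
  rw [h.eq_pair_union hi]
  exact (h.pendant.hanging_pair hi hpi).union (h.pathCover_erase hi) (h.pendant.disjoint_erase hi)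

/-- Since every vertex of a sun is a possible entry, linking suns through `X` is restricted by
adjacency alone; this turns Hall's condition into the sun bound. -/
theorem IsSunSet.hanging [Finite V] (h : IsSunSet G C) (hp : p ∈ C) : Hanging G 1 C p := by
  rcases h with ⟨v, rfl⟩ | ⟨K, f, h⟩
  · obtain rfl : p = v := hp
    exact hanging_singleton G p
  · exact (h.hanging hp).weaken one_le_two

/-- In a corona other than `K₂`, the part off one pendant pair hangs from any other pendant. -/
theorem IsCorona.hanging_erase [Finite V] (h : IsCorona G C K f) (hi : i ∈ K) (hj : j ∈ K)
    (hij : i ≠ j) : Hanging G 4 (K \ {j} ∪ f '' (K \ {j})) (f i) :=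
  have hi' : i ∈ K \ {j} := ⟨hi, hij⟩
  have h' := h.pendant.subset (L := K \ {j}) Set.sdiff_subset
  h'.insert_sdiff hi' (h'.hanging (h.critical j hj) hi')

/-- A corona other than `K₂` minus a pendant vertex is covered. -/
theorem IsCorona.pathCover_sdiff_pendant [Finite V] (h : IsCorona G C K f) (hi : i ∈ K)
    (hK : K ≠ {i}) : PathCover G (C \ {f i}) := by
  obtain ⟨k, hk, hki⟩ : ∃ k ∈ K, k ≠ i := by
    by_contra! hc
    exact hK (Set.eq_singleton_iff_unique_mem.mpr ⟨hi, hc⟩)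
  -- This matching serves only to find a neighbour `j` of `i` in `K`; the cover uses the matching of
  -- `K \ {j}`, whose path from `i` is prolonged by `j` and `f j`.
  obtain ⟨g, hg⟩ := h.critical k hk
  obtain ⟨hj, hij, -⟩ := hg i ⟨hi, hki.symm⟩
  set j := g i
  have hi' : i ∈ K \ {j} := ⟨hi, hij.ne⟩
  have h' := h.pendant.subset (L := K \ {j}) Set.sdiff_subset
  have h1 := h'.hanging (h.critical j hj.1) hi'
  have h2 := h.pendant.hanging_pair hj.1 (Or.inl rfl)
  have h3 := h2.join h1 ((h.pendant.disjoint_erase hj.1).mono_right Set.sdiff_subset) hij.symm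
    (by norm_num)
  convert h3 using 1
  rw [h.eq_pair_union hj.1, Set.union_sdiff_distrib, Set.sdiff_singleton_eq_self]
  rintro (h4 | h4)
  · exact h.pendant.ne hi hj.1 h4
  · exact hij.ne (h.pendant.inj hi hj.1 h4)

/-- A set hanging at a vertex `w` of a corona, where `p` is another possible entry vertex. -/
theorem IsCorona.hanging_union [Finite V] (h : IsCorona G B K f) (hp : p ∈ B) (hw : w ∈ B)
    (hcore : w ∈ K → p = f w) (hpend : ∀ i ∈ K, w = f i → K ≠ {i}) (hA : Hanging G 1 A a)
    (hwa : G.Adj w a) (hd : Disjoint B A) : Hanging G 1 (B ∪ A) p := by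
  -- When `p` and `w` are a core vertex and its pendant, the path runs `p`, `w` and on into `A`, and
  -- criticality covers the other pairs.
  have key : ∀ i ∈ K, ∀ p w : V, p ∈ B → w ∈ B → G.Adj p w → G.Adj w a →
      ({w, p} : Set V) = {i, f i} → Hanging G 1 (B ∪ A) p := by
    intro i hi p w hp hw hpw hwa he
    have h1 := hA.cons (Set.disjoint_left.mp hd hw) hwa
    have h2 := h1.cons (x := p) (by
      rintro (h' | h')
      · exact hpw.ne h'
      · exact Set.disjoint_left.mp hd hp h') hpw
    have h3 : insert p (insert w A) = {i, f i} ∪ A := by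
      rw [← he, Set.insert_comm, Set.insert_union, Set.singleton_union]
    rw [h3] at h2
    have h4 := h2.union (h.pathCover_erase hi) (by
      rw [Set.disjoint_union_left]
      refine ⟨h.pendant.disjoint_erase hi, hd.symm.mono_right ?_⟩
      rw [h.eq_pair_union hi]
      exact Set.subset_union_right)
    rw [h.eq_pair_union hi, Set.union_right_comm]
    exact h4.weaken (by norm_num)
  obtain ⟨i, hi, rfl | rfl⟩ := h.mem_iff.mp hw
  · obtain rfl := hcore hi
    exact key w hi _ w hp hw (h.pendant.adj w hi).symm hwa rfl
  · obtain ⟨j, hj, hpj⟩ := h.mem_iff.mp hp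
    by_cases hij : i = j
    · subst hij
      rcases hpj with rfl | rfl
      · exact key p hi p (f p) hp hw (h.pendant.adj p hi) hwa (Set.pair_comm _ _)
      · have h1 := hA.cons (Set.disjoint_left.mp hd hw) hwa
        have h2 := h1.union (h.pathCover_sdiff_pendant hi (hpend i hi rfl)) (by
          rw [Set.disjoint_left]
          rintro x (rfl | hx) hx'
          · exact hx'.2 rfl
          · exact Set.disjoint_left.mp hd hx'.1 hx)
        have h3 : insert (f i) A ∪ B \ {f i} = B ∪ A := by
          ext x
          simp only [Set.mem_union, Set.mem_insert_iff, Set.mem_sdiff, Set.mem_singleton_iff]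
          by_cases hx : x = f i
          · subst hx; simp [hw]
          · simp only [hx]; tauto
        rw [h3] at h2
        exact h2.weaken (by norm_num)
    -- The pair of `p` serves as entry path, while the path into `A` is prolonged backwards through
    -- `w = f i` over the rest of the corona.
    · have h1 := h.hanging_erase hi hj hij
      have hsub : K \ {j} ∪ f '' (K \ {j}) ⊆ B := by
        rw [h.eq_pair_union hj]
        exact Set.subset_union_right
      have h2 := h1.join hA (hd.mono_left hsub) hwa (by norm_num)
      have h3 := (h.pendant.hanging_pair hj hpj).union h2 (by
        rw [Set.disjoint_union_right]
        refine ⟨h.pendant.disjoint_erase hj, hd.mono_left ?_⟩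
        rw [h.eq_pair_union hj]
        exact Set.subset_union_left)
      rw [← Set.union_assoc, ← h.eq_pair_union hj] at h3
      exact h3.weaken (by norm_num)

/-- A corona together with a further edge at a pendant vertex is covered. -/
theorem IsCorona.pathCover_of_adj [Finite V] (h : IsCorona G C K f) (hG : G ≤ G') (hi : i ∈ K)
    (ha : a ∈ C) (hai : a ≠ i) (hadj : G'.Adj (f i) a) : PathCover G' C := by
  obtain ⟨j, hj, haj⟩ := h.mem_iff.mp ha
  have hij : i ≠ j := by
    rintro rfl
    rcases haj with rfl | rfl
    · exact hai rfl
    · exact hadj.ne rfl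
  have h1 := (h.hanging_erase hi hj hij).mono hG
  have h2 := (h.pendant.hanging_pair hj haj).mono hG
  have h3 := h2.join h1 (h.pendant.disjoint_erase hj) hadj.symm (by norm_num)
  rwa [← h.eq_pair_union hj] at h3

theorem IsCorona.ncard_eq [Finite V] (h : IsCorona G C K f) : C.ncard = 2 * K.ncard := by
  rw [h.eq, Set.ncard_union_eq, h.pendant.inj.ncard_image, two_mul]
  rw [Set.disjoint_left]
  rintro x hx ⟨y, hy, rfl⟩
  exact h.pendant.notMem y hy hx

end Coronas

/-! ### Linking hanging sets by Hall's theorem. -/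

section Assembly

variable {V : Type*} [Finite V]

/-- Hall's theorem, each element of `X` being matched twice. -/
theorem exists_two_matching {β : Type*} [Finite β] [Nonempty β] (X : Set V) (F : Set β) (r : β → V → Prop)
    (hcard : F.ncard = 2 * X.ncard)
    (hall : ∀ S ⊆ F, S.ncard ≤ 2 * {x ∈ X | ∃ C ∈ S, r C x}.ncard) :
    ∃ c : V → Bool → β, (∀ x ∈ X, ∀ b, c x b ∈ F ∧ r (c x b) x) ∧
      (∀ x ∈ X, ∀ y ∈ X, ∀ b d, c x b = c y d → x = y ∧ b = d) ∧
      ∀ C ∈ F, ∃ x ∈ X, ∃ b, c x b = C := by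
  classical
  have := Fintype.ofFinite V
  have := Fintype.ofFinite β
  -- Two copies of each vertex of `X` reduce the statement to ordinary Hall; `hcard` makes the
  -- resulting injection a bijection.
  let t : F → Finset (X × Bool) := fun C => Finset.univ.filter fun z => r C z.1
  have h1 : ∀ s : Finset F, s.card ≤ (s.biUnion t).card := by
    intro s
    have h2 := hall (Subtype.val '' (s : Set F)) (by rintro _ ⟨C, -, rfl⟩; exact C.2)
    rw [Set.ncard_image_of_injective _ Subtype.val_injective, Set.ncard_coe_finset] at h2
    refine h2.trans ?_
    let N : Finset X := Finset.univ.filter fun x => ∃ C ∈ s, r C x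
    have h3 : {x ∈ X | ∃ C ∈ Subtype.val '' (s : Set F), r C x} =
        Subtype.val '' (N : Set X) := by
      ext x
      simp [N]
      tauto
    have h4 : s.biUnion t = N ×ˢ Finset.univ := by
      ext ⟨x, b⟩
      simp [t, N]
    rw [h3, Set.ncard_image_of_injective _ Subtype.val_injective, Set.ncard_coe_finset, h4,
      Finset.card_product, Finset.card_univ, Fintype.card_bool, mul_comm]
  obtain ⟨φ, hφ, hφt⟩ := (Finset.all_card_le_biUnion_card_iff_exists_injective t).mp h1
  have hb : Function.Bijective φ := by
    rw [Fintype.bijective_iff_injective_and_card]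
    refine ⟨hφ, ?_⟩
    rw [Fintype.card_prod, Fintype.card_bool, ← Nat.card_eq_fintype_card,
      ← Nat.card_eq_fintype_card, Nat.card_coe_set_eq, Nat.card_coe_set_eq, hcard, mul_comm]
  let e := Equiv.ofBijective φ hb
  have hr : ∀ z, r (e.symm z).1 z.1 := fun z => by
    have := hφt (e.symm z)
    have h5 : φ (e.symm z) = z := e.apply_symm_apply z
    rw [h5] at this
    exact (Finset.mem_filter.mp this).2
  refine ⟨fun x b => if hx : x ∈ X then (e.symm (⟨x, hx⟩, b)).1 else Classical.arbitrary β,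
    ?_, ?_, ?_⟩
  · intro x hx b
    simp only [hx, dif_pos]
    exact ⟨Subtype.coe_prop _, hr (⟨x, hx⟩, b)⟩
  · intro x hx y hy b d h
    simp only [hx, hy, dif_pos] at h
    have := e.symm.injective (Subtype.ext h)
    simpa using this
  · intro C hC
    refine ⟨(e ⟨C, hC⟩).1, Subtype.coe_prop _, (e ⟨C, hC⟩).2, ?_⟩
    simp

/-- Hanging sets can be linked in pairs by the vertices of `X` if Hall's condition holds. -/
theorem pathCover_of_hall {G : SimpleGraph V} (X : Set V) (F : Set (Set V))
    (hd : ∀ C ∈ F, ∀ D ∈ F, C ≠ D → Disjoint C D) (hX : ∀ C ∈ F, Disjoint X C)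
    (hcard : F.ncard = 2 * X.ncard)
    (hall : ∀ S ⊆ F, S.ncard ≤
      2 * {x ∈ X | ∃ C ∈ S, ∃ p ∈ C, G.Adj x p ∧ Hanging G 1 C p}.ncard) :
    PathCover G (X ∪ ⋃₀ F) := by
  obtain ⟨c, hc, hinj, hsurj⟩ := exists_two_matching X F
    (fun C x => ∃ p ∈ C, G.Adj x p ∧ Hanging G 1 C p) hcard hall
  have hne : ∀ x ∈ X, ∀ y ∈ X, ∀ b d, (x ≠ y ∨ b ≠ d) → Disjoint (c x b) (c y d) := by
    intro x hx y hy b d h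
    refine hd _ (hc x hx b).1 _ (hc y hy d).1 fun he => ?_
    have := hinj x hx y hy b d he
    tauto
  have hnot : ∀ x ∈ X, ∀ y ∈ X, ∀ b, x ∉ c y b := fun x hx y hy b =>
    Set.disjoint_left.mp (hX _ (hc y hy b).1) hx
  have key := PathCover.biUnion (G := G) X.toFinite.toFinset
    (fun x => insert x (c x false ∪ c x true)) (by
      intro x hx
      rw [Set.Finite.mem_toFinset] at hx
      obtain ⟨p, -, hxp, hp⟩ := (hc x hx false).2
      obtain ⟨q, -, hxq, hq⟩ := (hc x hx true).2
      exact hp.link hq (hne x hx x hx _ _ (Or.inr (by simp))) (hnot x hx x hx _)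
        (hnot x hx x hx _) hxp hxq) (by
      intro x hx y hy hxy
      rw [Set.Finite.mem_toFinset] at hx hy
      have h := fun b d => hne x hx y hy b d (Or.inl hxy)
      have h1 := fun b => hnot x hx y hy b
      have h2 := fun b => hnot y hy x hx b
      simp [h, h1, h2, hxy.symm])
  convert key using 1
  ext z
  simp only [Set.mem_union, Set.mem_sUnion, Set.mem_iUnion, Set.Finite.mem_toFinset,
    Set.mem_insert_iff, exists_prop]
  constructor
  · rintro (hz | ⟨C, hC, hz⟩)
    · exact ⟨z, hz, Or.inl rfl⟩
    · obtain ⟨x, hx, b, rfl⟩ := hsurj C hC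
      cases b
      · exact ⟨x, hx, Or.inr (Or.inl hz)⟩
      · exact ⟨x, hx, Or.inr (Or.inr hz)⟩
  · rintro ⟨x, hx, rfl | hz | hz⟩
    · exact Or.inl hx
    · exact Or.inr ⟨_, (hc x hx _).1, hz⟩
    · exact Or.inr ⟨_, (hc x hx _).1, hz⟩

end Assembly

/-! ### Tutte's theorem with factor-critical components. -/

section GallaiTutte

variable {V : Type*}

/-- The components of odd order of the subgraph induced by `U`. -/
def oddComps (G : SimpleGraph V) (U : Set V) : Set (Set V) :=
  {C | IsComp G U C ∧ Odd C.ncard}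

theorem ncard_oddComps_range {W : Type*} {G : SimpleGraph V} {H : SimpleGraph W} (φ : H ↪g G) :
    (oddComps G (Set.range φ)).ncard = H.oddComponents.ncard := by
  rw [← Set.ncard_image_of_injective _ (image_supp_injective φ)]
  congr 1
  ext C
  simp only [oddComps, Set.mem_ofPred_eq, isComp_range_iff, Set.mem_image,
    SimpleGraph.oddComponents]
  constructor
  · rintro ⟨⟨c, rfl⟩, h⟩
    rw [Set.ncard_image_of_injective _ φ.injective] at h
    exact ⟨c, h, rfl⟩
  · rintro ⟨c, h, rfl⟩
    rw [Set.ncard_image_of_injective _ φ.injective]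
    exact ⟨⟨c, rfl⟩, h⟩

theorem range_induce_embedding (G : SimpleGraph V) (U : Set V) :
    Set.range (SimpleGraph.Embedding.induce (G := G) U) = U :=
  Subtype.range_coe

theorem odd_ncard_oddComps [Finite V] (G : SimpleGraph V) (U : Set V) :
    Odd (oddComps G U).ncard ↔ Odd U.ncard := by
  have h := ncard_oddComps_range (SimpleGraph.Embedding.induce (G := G) U)
  rw [range_induce_embedding] at h
  rw [h, SimpleGraph.odd_ncard_oddComponents, Nat.card_coe_set_eq]

/-- Tutte's theorem for an induced subgraph, transported to vertex sets. -/
theorem hasMatching_or_exists_lt_oddComps [Finite V] (G : SimpleGraph V) (W : Set V) :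
    HasMatching G W ∨ ∃ X ⊆ W, X.ncard < (oddComps G (W \ X)).ncard := by
  by_cases hT : ∃ M : (G.induce W).Subgraph, M.IsPerfectMatching
  · left
    obtain ⟨M, hM⟩ := hT
    have hex : ∀ v : W, ∃! w, M.Adj v w := fun v => hM.1 (hM.2 v)
    choose g hg hg' using hex
    classical
    refine ⟨fun v => if hv : v ∈ W then g ⟨v, hv⟩ else v, fun v hv => ?_⟩
    have h1 : (g ⟨v, hv⟩ : V) ∈ W := (g ⟨v, hv⟩).2
    simp only [hv, dif_pos, h1]
    refine ⟨trivial, (hg ⟨v, hv⟩).adj_sub, ?_⟩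
    rw [← hg' (g ⟨v, hv⟩) ⟨v, hv⟩ (hg ⟨v, hv⟩).symm]
  · right
    rw [SimpleGraph.tutte] at hT
    push Not at hT
    obtain ⟨u, hu⟩ := hT
    refine ⟨Subtype.val '' u, by rintro _ ⟨x, -, rfl⟩; exact x.2, ?_⟩
    rw [Set.ncard_image_of_injective _ Subtype.val_injective]
    let φ : ((⊤ : (G.induce W).Subgraph).deleteVerts u).coe ↪g G :=
      { toFun := fun x => x.1.1
        inj' := fun x y h => Subtype.ext (Subtype.ext h)
        map_rel_iff' := by
          rintro ⟨x, hx⟩ ⟨y, hy⟩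
          simp at hx hy
          simp only [SimpleGraph.Subgraph.coe_adj, SimpleGraph.Subgraph.deleteVerts_adj]
          simp [hx, hy]
          rfl }
    have hr : Set.range φ = W \ Subtype.val '' u := by
      ext x
      constructor
      · rintro ⟨⟨y, hy⟩, rfl⟩
        simp at hy
        refine ⟨y.2, ?_⟩
        rintro ⟨z, hz, hzy⟩
        exact hy ((Subtype.ext hzy : z = y) ▸ hz)
      · rintro ⟨hx, hxu⟩
        exact ⟨⟨⟨x, hx⟩, by simpa using fun h => hxu ⟨_, h, rfl⟩⟩, rfl⟩
    have h := ncard_oddComps_range φ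
    rw [hr] at h
    rw [h]
    exact hu

/-- If `W` has no perfect matching, deleting a suitable set `X` leaves more than `|X|`
factor-critical components. -/
theorem hasMatching_or_exists_lt_critical [Finite V] (G : SimpleGraph V) (W : Set V) :
    HasMatching G W ∨ ∃ X ⊆ W, X.ncard <
      {C | IsComp G (W \ X) C ∧ ∀ c ∈ C, HasMatching G (C \ {c})}.ncard := by
  refine (hasMatching_or_exists_lt_oddComps G W).imp_right ?_
  rintro ⟨X₀, hX₀W, hX₀⟩
  -- The weight `|W| + 1` makes this a lexicographic maximum: first the deficiency, then the size of
  -- `X`.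
  obtain ⟨X, ⟨hXW, hX⟩, hmax⟩ := Set.exists_max_image
    {X | X ⊆ W ∧ X.ncard < (oddComps G (W \ X)).ncard}
    (fun X => (((oddComps G (W \ X)).ncard : ℤ) - X.ncard) * (W.ncard + 1) + X.ncard)
    (Set.toFinite _) ⟨X₀, hX₀W, hX₀⟩
  refine ⟨X, hXW, hX.trans_le (Set.ncard_le_ncard ?_)⟩
  rintro C ⟨hC, hodd⟩
  refine ⟨hC, fun c hc => ?_⟩
  by_contra hno
  obtain ⟨Y, hYC, hY⟩ := (hasMatching_or_exists_lt_oddComps G (C \ {c})).resolve_left hno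
  have hCW : C ⊆ W \ X := hC.subset
  have hcY : c ∉ Y := fun h => (hYC h).2 rfl
  -- `C \ {c}` has even order, so the number of odd components left by `Y` has the parity of `|Y|`;
  -- exceeding it means exceeding it by two.
  have hpar : Y.ncard + 2 ≤ (oddComps G ((C \ {c}) \ Y)).ncard := by
    have h1 := odd_ncard_oddComps G ((C \ {c}) \ Y)
    have h2 : ((C \ {c}) \ Y).ncard + Y.ncard = (C \ {c}).ncard :=
      Set.ncard_sdiff_add_ncard_of_subset hYC
    have h3 := Set.ncard_sdiff_singleton_add_one hc
    by_contra hlt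
    have h4 : (oddComps G ((C \ {c}) \ Y)).ncard = Y.ncard + 1 := by omega
    rw [h4] at h1
    rw [Nat.odd_iff] at hodd
    rw [Nat.odd_iff, Nat.odd_iff] at h1
    omega
  have hYX : Disjoint X (insert c Y) := by
    rw [Set.disjoint_left]
    rintro x hx (rfl | hxY)
    · exact (hCW hc).2 hx
    · exact (hCW (hYC hxY).1).2 hx
  -- Passing to `Z` loses the component `C` and gains at least `|Y| + 2`, for `|Y| + 1` new
  -- vertices: the deficiency does not drop, yet `Z` is larger.
  let Z := X ∪ insert c Y
  have hZ : Z.ncard = X.ncard + (Y.ncard + 1) := by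
    rw [Set.ncard_union_eq hYX, Set.ncard_insert_of_notMem hcY]
  have hZW : Z ⊆ W := by
    rintro x (hx | rfl | hx)
    · exact hXW hx
    · exact (hCW hc).1
    · exact (hCW (hYC hx).1).1
  have hsub : (oddComps G (W \ X) \ {C}) ∪ oddComps G ((C \ {c}) \ Y) ⊆ oddComps G (W \ Z) := by
    rintro D (⟨⟨hD, hDo⟩, hDC⟩ | ⟨hD, hDo⟩)
    · refine ⟨hD.mono (fun x hx => ⟨(hD.subset hx).1, ?_⟩) (fun x hx =>
        ⟨hx.1, fun h => hx.2 (Or.inl h)⟩), hDo⟩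
      have hdis := Set.disjoint_left.mp (hD.disjoint hC hDC) hx
      rintro (h | rfl | h)
      · exact (hD.subset hx).2 h
      · exact hdis hc
      · exact hdis (hYC h).1
    · refine ⟨hD.congr (fun x hx => ?_) (fun x hx y hy hxy => ⟨⟨⟨?_, ?_⟩, ?_⟩, hxy⟩)
        (fun _ _ _ _ h => h), hDo⟩
      · have h := hD.subset hx
        refine ⟨(hCW h.1.1).1, ?_⟩
        rintro (h' | h' | h')
        · exact (hCW h.1.1).2 h'
        · exact h.1.2 h'
        · exact h.2 h'
      · exact hC.closed x (hD.subset hx).1.1 y ⟨hy.1, fun h => hy.2 (Or.inl h)⟩ hxy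
      · exact fun h => hy.2 (Or.inr (Or.inl h))
      · exact fun h => hy.2 (Or.inr (Or.inr h))
  have hdis : Disjoint (oddComps G (W \ X) \ {C}) (oddComps G ((C \ {c}) \ Y)) := by
    rw [Set.disjoint_left]
    rintro D ⟨⟨hD, -⟩, hDC⟩ ⟨hD', -⟩
    obtain ⟨x, hx⟩ := hD.nonempty
    exact hDC (hD.eq_of_mem hC hx (hD'.subset hx).1.1)
  have hle := Set.ncard_le_ncard hsub
  rw [Set.ncard_union_eq hdis] at hle
  have hC1 := Set.ncard_sdiff_singleton_add_one (s := oddComps G (W \ X)) (a := C) ⟨hC, hodd⟩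
  have hXle := Set.ncard_le_ncard hXW
  have := hmax Z ⟨hZW, by omega⟩
  have hge : ((oddComps G (W \ X)).ncard : ℤ) - X.ncard ≤
      (oddComps G (W \ Z)).ncard - Z.ncard := by omega
  have := mul_le_mul_of_nonneg_right hge (by positivity : (0 : ℤ) ≤ W.ncard + 1)
  omega

end GallaiTutte

/-! ### Counting suns, and the effect of deleting an edge. -/

section SunCounting

variable {V : Type*}

/-- The sun components of the subgraph induced by `U`. -/
def sunSets (G : SimpleGraph V) (U : Set V) : Set (Set V) :=
  {C | IsComp G U C ∧ IsSunSet G C}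

/-- Every set `X` leaves at most `2 * |X|` sun components in the subgraph induced by `U`. -/
def SunBound (G : SimpleGraph V) (U : Set V) : Prop :=
  ∀ X ⊆ U, (sunSets G (U \ X)).ncard ≤ 2 * X.ncard

variable {G G' : SimpleGraph V} {A B C U X Y : Set V} {S : Set (Set V)} {a p w x y : V}

theorem deleteEdge_adj (h : G.Adj x y) (h1 : ¬ (x = w ∧ y = a)) (h2 : ¬ (x = a ∧ y = w)) :
    (G.deleteEdges {s(w, a)}).Adj x y := by
  rw [SimpleGraph.deleteEdges_adj]
  refine ⟨h, fun h' => ?_⟩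
  rw [Set.mem_singleton_iff, Sym2.eq_iff] at h'
  exact h'.elim h1 h2

theorem deleteEdge_le (G : SimpleGraph V) (w a : V) : G.deleteEdges {s(w, a)} ≤ G :=
  SimpleGraph.deleteEdges_le _

theorem not_deleteEdge_adj (G : SimpleGraph V) (w a : V) :
    ¬ (G.deleteEdges {s(w, a)}).Adj w a := by
  simp [SimpleGraph.deleteEdges_adj]

theorem deleteEdge_adj_iff (h1 : ¬ (x = w ∧ y = a)) (h2 : ¬ (x = a ∧ y = w)) :
    (G.deleteEdges {s(w, a)}).Adj x y ↔ G.Adj x y :=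
  ⟨fun h => deleteEdge_le G w a h, fun h => deleteEdge_adj h h1 h2⟩

/-- As `C` is not itself counted, the old suns survive the deletion of `Y` and those inside `C` are
new. This passes the sun bound on to non-sun components. -/
theorem ncard_sunSets_add_le [Finite V] (hC : IsComp G (U \ X) C) (hns : ¬ IsSunSet G C)
    (hY : Y ⊆ C) :
    (sunSets G (U \ X)).ncard + (sunSets G (C \ Y)).ncard ≤ (sunSets G (U \ (X ∪ Y))).ncard := by
  rw [← Set.ncard_union_eq]
  · refine Set.ncard_le_ncard ?_ (Set.toFinite _)
    rintro D (⟨hD, hDs⟩ | ⟨hD, hDs⟩)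
    · have hDC : D ≠ C := by
        rintro rfl
        exact hns hDs
      have hdis := hD.disjoint hC hDC
      refine ⟨hD.mono (fun x hx => ⟨(hD.subset hx).1, ?_⟩)
        (fun x hx => ⟨hx.1, fun h => hx.2 (Or.inl h)⟩), hDs⟩
      rintro (h | h)
      · exact (hD.subset hx).2 h
      · exact Set.disjoint_left.mp hdis hx (hY h)
    · refine ⟨hD.of_closed ?_ ?_, hDs⟩
      · rintro x ⟨hxC, hxY⟩
        exact ⟨(hC.subset hxC).1, fun h => h.elim (hC.subset hxC).2 hxY⟩
      · rintro x ⟨hxC, hxY⟩ y ⟨hyU, hy⟩ hxy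
        exact ⟨hC.closed x hxC y ⟨hyU, fun h => hy (Or.inl h)⟩ hxy, fun h => hy (Or.inr h)⟩
  · rw [Set.disjoint_left]
    rintro D ⟨hD, hDs⟩ ⟨hD', -⟩
    obtain ⟨x, hx⟩ := hD.nonempty
    obtain rfl := hD.eq_of_mem hC hx (hD'.subset hx).1
    exact hns hDs

/-- The vertices of `X` that can link to a member of `S`. -/
def linkers (G : SimpleGraph V) (X : Set V) (S : Set (Set V)) : Set V :=
  {x ∈ X | ∃ C ∈ S, ∃ p ∈ C, G.Adj x p ∧ Hanging G 1 C p}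

theorem linkers_subset (G : SimpleGraph V) (X : Set V) (S : Set (Set V)) : linkers G X S ⊆ X :=
  fun _ h => h.1

theorem linkers_mono {T : Set (Set V)} (h : S ⊆ T) : linkers G X S ⊆ linkers G X T := by
  rintro x ⟨hx, C, hC, hp⟩
  exact ⟨hx, C, h hC, hp⟩

/-- Any neighbour in `X` of a member of `S` is a linker, so deleting the linkers alone already
isolates `S`. The sun bound at the linkers is thus Hall's condition for `S`. -/
theorem subset_sunSets_linkers [Finite V] (hG : G' ≤ G) (hS : S ⊆ sunSets G' (U \ X)) :
    S ⊆ sunSets G' (U \ linkers G X S) := by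
  intro C hCS
  obtain ⟨hC, hCs⟩ := hS hCS
  refine ⟨hC.congr (fun x hx => ⟨(hC.subset hx).1, fun h => (hC.subset hx).2 h.1⟩)
    (fun x hx y hy hxy => ⟨⟨hy.1, fun hyX => hy.2 ⟨hyX, C, hCS, x, hx, hG hxy.symm, ?_⟩⟩, hxy⟩)
    (fun _ _ _ _ h => h), hCs⟩
  exact (hCs.hanging hx).mono hG

theorem mem_sunSets_of_deleteEdge (hC : C ∈ sunSets (G.deleteEdges {s(w, a)}) U)
    (h : ¬ (w ∈ U ∧ a ∈ U ∧ (w ∈ C ∨ a ∈ C))) : C ∈ sunSets G U := by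
  have key : ∀ x ∈ C, ∀ y ∈ U, ((G.deleteEdges {s(w, a)}).Adj x y ↔ G.Adj x y) := by
    intro x hx y hy
    apply deleteEdge_adj_iff
    · rintro ⟨rfl, rfl⟩
      exact h ⟨hC.1.subset hx, hy, Or.inl hx⟩
    · rintro ⟨rfl, rfl⟩
      exact h ⟨hy, hC.1.subset hx, Or.inr hx⟩
  exact ⟨hC.1.congr hC.1.subset (fun x hx y hy hxy => ⟨hy, (key x hx y hy).mpr hxy⟩)
    fun x hx y hy hxy => (key x hx y (hC.1.subset hy)).mp hxy,
    hC.2.congr fun x hx y hy => key x hx y (hC.1.subset hy)⟩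

theorem exists_sunSets_diff_subset (G : SimpleGraph V) (U : Set V) (w a : V) :
    sunSets (G.deleteEdges {s(w, a)}) U ⊆ sunSets G U ∨ ∃ A B : Set V,
      IsComp (G.deleteEdges {s(w, a)}) U A ∧ IsComp (G.deleteEdges {s(w, a)}) U B ∧ a ∈ A ∧ w ∈ B ∧
      sunSets (G.deleteEdges {s(w, a)}) U \ sunSets G U ⊆ {A, B} := by
  by_cases hU : w ∈ U ∧ a ∈ U
  · right
    obtain ⟨B, hB, hwB⟩ := exists_isComp_mem (G.deleteEdges {s(w, a)}) hU.1
    obtain ⟨A, hA, haA⟩ := exists_isComp_mem (G.deleteEdges {s(w, a)}) hU.2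
    refine ⟨A, B, hA, hB, haA, hwB, ?_⟩
    rintro C ⟨hC, hC'⟩
    have := mt (mem_sunSets_of_deleteEdge hC) hC'
    rw [not_not] at this
    rcases this.2.2 with h | h
    · exact Or.inr (hC.1.eq_of_mem hB h hwB)
    · exact Or.inl (hC.1.eq_of_mem hA h haA)
  · left
    intro C hC
    exact mem_sunSets_of_deleteEdge hC fun h => hU ⟨h.1, h.2.1⟩

theorem ncard_sunSets_deleteEdge_le [Finite V] (G : SimpleGraph V) (U : Set V) (w a : V) :
    (sunSets (G.deleteEdges {s(w, a)}) U).ncard ≤ (sunSets G U).ncard + 2 := by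
  rcases exists_sunSets_diff_subset G U w a with h | ⟨A, B, -, -, -, -, h⟩
  · exact (Set.ncard_le_ncard h).trans (Nat.le_add_right _ _)
  · have h1 := Set.ncard_le_ncard h
    have h2 : ({A, B} : Set (Set V)).ncard ≤ 2 := by
        simpa using Set.ncard_insert_le A {B}
    have h3 := Set.ncard_le_ncard_sdiff_add_ncard (sunSets (G.deleteEdges {s(w, a)}) U)
      (sunSets G U)
    omega

/-- All new suns contain an end of the deleted edge, so a gain of two requires distinct suns at the
two ends. -/
theorem exists_pair_of_ncard_sunSets [Finite V]
    (h : (sunSets G U).ncard + 2 ≤ (sunSets (G.deleteEdges {s(w, a)}) U).ncard) :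
    ∃ A ∈ sunSets (G.deleteEdges {s(w, a)}) U, ∃ B ∈ sunSets (G.deleteEdges {s(w, a)}) U,
      A ≠ B ∧ a ∈ A ∧ w ∈ B := by
  rcases exists_sunSets_diff_subset G U w a with h0 | ⟨A, B, -, -, haA, hwB, h0⟩
  · have := Set.ncard_le_ncard h0
    omega
  · have h3 := Set.ncard_le_ncard_sdiff_add_ncard (sunSets (G.deleteEdges {s(w, a)}) U)
      (sunSets G U)
    have hAB : A ≠ B := by
      rintro rfl
      have := Set.ncard_le_ncard h0
      rw [Set.pair_eq_singleton, Set.ncard_singleton] at this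
      omega
    have h4 := Set.eq_of_subset_of_ncard_le h0 (by
      have h2 : ({A, B} : Set (Set V)).ncard ≤ 2 := by
        simpa using Set.ncard_insert_le A {B}
      omega)
    have hA : A ∈ ({A, B} : Set (Set V)) := Or.inl rfl
    have hB : B ∈ ({A, B} : Set (Set V)) := Or.inr rfl
    rw [← h4] at hA hB
    exact ⟨A, hA.1, B, hB.1, hAB, haA, hwB⟩

theorem pathCover_of_suns_and_others [Finite V] (hG : G' ≤ G) (hXU : X ⊆ U)
    (hsun : PathCover G (X ∪ ⋃₀ sunSets G' (U \ X)))
    (hns : ∀ C, IsComp G' (U \ X) C → ¬ IsSunSet G' C → PathCover G' C) : PathCover G U := by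
  have h1 : PathCover G (⋃₀ {C | IsComp G' (U \ X) C ∧ ¬ IsSunSet G' C}) :=
    PathCover.sUnion _ (fun C hC => (hns C hC.1 hC.2).mono hG)
      fun C hC D hD h => hC.1.disjoint hD.1 h
  have h2 := hsun.union h1 (by
    rw [Set.disjoint_left]
    rintro x (hx | ⟨C, hC, hxC⟩) ⟨D, hD, hxD⟩
    · exact (hD.1.subset hxD).2 hx
    · obtain rfl := hC.1.eq_of_mem hD.1 hxC hxD
      exact hD.2 hC.2)
  convert h2 using 1
  rw [Set.union_assoc, ← Set.sUnion_union]
  have h3 : sunSets G' (U \ X) ∪ {C | IsComp G' (U \ X) C ∧ ¬ IsSunSet G' C} =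
      {C | IsComp G' (U \ X) C} := by
    ext C
    simp only [sunSets, Set.mem_union, Set.mem_ofPred_eq]
    tauto
  rw [h3, sUnion_isComp, Set.union_sdiff_cancel hXU]

/-- If the sun bound is tight at `X`, the suns can be linked in pairs by `X`. -/
theorem pathCover_of_tight [Finite V] (hb : SunBound G U) (hXU : X ⊆ U)
    (htight : (sunSets G (U \ X)).ncard = 2 * X.ncard)
    (ih : ∀ C, IsComp G (U \ X) C → SunBound G C → PathCover G C) : PathCover G U := by
  refine pathCover_of_suns_and_others le_rfl hXU ?_ ?_
  · refine pathCover_of_hall X _ (fun C hC D hD h => hC.1.disjoint hD.1 h)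
      (fun C hC => Set.disjoint_left.mpr fun x hx hxC => (hC.1.subset hxC).2 hx) htight ?_
    intro S hS
    exact (Set.ncard_le_ncard (subset_sunSets_linkers le_rfl hS)).trans
      (hb _ ((linkers_subset G X S).trans hXU))
  · intro C hC hCs
    refine ih C hC fun Y hY => ?_
    have h1 := ncard_sunSets_add_le hC hCs hY
    have h2 := hb (X ∪ Y) (Set.union_subset hXU (hY.trans (hC.subset.trans Set.sdiff_subset)))
    have h3 := Set.ncard_union_le X Y
    omega

/-- If deleting an edge produces one sun too many at `X`, the two suns at its ends can be linked
to the remaining ones through a common hanging set. -/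
theorem pathCover_of_merged [Finite V] (hG : G' ≤ G) (hXU : X ⊆ U)
    (hA : A ∈ sunSets G' (U \ X)) (hB : B ∈ sunSets G' (U \ X)) (hAB : A ≠ B)
    (hcard : (sunSets G' (U \ X)).ncard = 2 * X.ncard + 1)
    (hx : x ∈ X) (hp : p ∈ B) (hxp : G.Adj x p) (hBA : Hanging G 1 (B ∪ A) p)
    (hb : ∀ S ⊆ sunSets G' (U \ X) \ {A, B}, S.Nonempty →
      S.ncard + 1 ≤ 2 * (linkers G X S).ncard)
    (ih : ∀ C, IsComp G' (U \ X) C → ¬ IsSunSet G' C → PathCover G' C) : PathCover G U := by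
  let F := insert (B ∪ A) (sunSets G' (U \ X) \ {A, B})
  have hAB2 : ({A, B} : Set (Set V)) ⊆ sunSets G' (U \ X) := by
    rintro C (rfl | rfl) <;> assumption
  have hunion : ∀ C ∈ sunSets G' (U \ X) \ {A, B}, Disjoint (B ∪ A) C := by
    rintro C ⟨hC, hCn⟩
    rw [Set.disjoint_union_left]
    exact ⟨hB.1.disjoint hC.1 fun h => hCn (Or.inr h.symm),
      hA.1.disjoint hC.1 fun h => hCn (Or.inl h.symm)⟩
  have hnot : B ∪ A ∉ sunSets G' (U \ X) \ {A, B} := fun h =>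
    Set.disjoint_left.mp (hunion _ h) (Or.inl hp) (Or.inl hp)
  have hXC : ∀ C ∈ sunSets G' (U \ X), Disjoint X C := fun C hC =>
    Set.disjoint_left.mpr fun z hz hzC => (hC.1.subset hzC).2 hz
  refine pathCover_of_suns_and_others hG hXU ?_ ih
  have hF : ⋃₀ sunSets G' (U \ X) = ⋃₀ F := by
    rw [Set.sUnion_insert]
    conv_lhs => rw [← Set.union_sdiff_cancel hAB2, Set.sUnion_union, Set.sUnion_pair]
    rw [Set.union_comm A B]
  rw [hF]
  refine pathCover_of_hall X F ?_ ?_ ?_ ?_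
  · rintro C (rfl | hC) D (rfl | hD) hne
    · exact absurd rfl hne
    · exact hunion D hD
    · exact (hunion C hC).symm
    · exact hC.1.1.disjoint hD.1.1 hne
  · rintro C (rfl | hC)
    · exact Set.disjoint_union_right.mpr ⟨hXC B hB, hXC A hA⟩
    · exact hXC C hC.1
  -- Merging two suns into one set turns `2|X| + 1` into the required `2|X|`.
  · rw [Set.ncard_insert_of_notMem hnot, Set.ncard_sdiff hAB2, Set.ncard_pair hAB, hcard]
    have : 0 < X.ncard := (Set.ncard_pos).mpr ⟨x, hx⟩
    omega
  · intro S hS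
    change S.ncard ≤ 2 * (linkers G X S).ncard
    have hS' : S \ {B ∪ A} ⊆ sunSets G' (U \ X) \ {A, B} := by
      rintro C ⟨hC, hCn⟩
      exact (hS hC).resolve_left hCn
    have hmono : (linkers G X (S \ {B ∪ A})).ncard ≤ (linkers G X S).ncard :=
      Set.ncard_le_ncard (linkers_mono Set.sdiff_subset)
    -- The slack of one in `hb` pays for the merged set; when that set is alone, `x` links it.
    by_cases hmem : B ∪ A ∈ S
    · have h1 := Set.ncard_sdiff_singleton_add_one hmem
      rcases (S \ {B ∪ A}).eq_empty_or_nonempty with he | hne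
      · rw [he, Set.ncard_empty] at h1
        have : 0 < (linkers G X S).ncard :=
          (Set.ncard_pos).mpr ⟨x, hx, B ∪ A, hmem, p, Or.inl hp, hxp, hBA⟩
        omega
      · have := hb _ hS' hne
        omega
    · rw [Set.sdiff_singleton_eq_self hmem] at hS'
      rcases S.eq_empty_or_nonempty with rfl | hne
      · simp
      · have := hb _ hS' hne
        omega

end SunCounting

/-! ### Minimal counterexamples: pendant neighbours. -/

section Kaneko

variable {V : Type*} {G : SimpleGraph V} {A B C K U X : Set V} {f : V → V} {a i w : V}

/-- The position of a vertex `w` without pendant neighbours in a sun component that is left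
by deleting the edge `wa` and the set `X`. -/
theorem sun_structure (hw : w ∈ U) (hpend : ∀ v ∈ U, G.Adj w v → ∃ y ∈ U, y ≠ w ∧ G.Adj v y)
    (hdeg : ∃ z ∈ U, z ≠ a ∧ G.Adj w z)
    (hB : B ∈ sunSets (G.deleteEdges {s(w, a)}) (U \ X)) (hwB : w ∈ B) (haB : a ∉ B) :
    (B = {w} ∧ ∃ x ∈ X, G.Adj x w) ∨ ∃ K f, IsCorona (G.deleteEdges {s(w, a)}) B K f ∧
      (w ∈ K → ∃ x ∈ X, G.Adj x (f w)) ∧ ∀ i ∈ K, w = f i → K ≠ {i} := by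
  obtain ⟨hBc, ⟨v, rfl⟩ | ⟨K, f, hK⟩⟩ := hB
  · obtain rfl : w = v := hwB
    obtain ⟨z, hz, hza, hwz⟩ := hdeg
    refine Or.inl ⟨rfl, z, ?_, hwz.symm⟩
    by_contra hzX
    have : z ∈ ({w} : Set V) := hBc.closed w rfl z ⟨hz, hzX⟩
      (deleteEdge_adj hwz (fun h => hza h.2) (fun h => hwz.ne h.2.symm))
    exact hwz.ne this.symm
  · right
    have key : ∀ K f, IsCorona (G.deleteEdges {s(w, a)}) B K f → w ∈ K →
        ∃ x ∈ X, G.Adj x (f w) := by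
      intro K f hK hwK
      have hfB := hK.map_mem hwK
      have hwf := deleteEdge_le G w a (hK.pendant.adj w hwK)
      obtain ⟨y, hyU, hyw, hfy⟩ := hpend (f w) (hBc.subset hfB).1 hwf
      refine ⟨y, ?_, hfy.symm⟩
      by_contra hyX
      have hadj : (G.deleteEdges {s(w, a)}).Adj (f w) y := by
        refine deleteEdge_adj hfy (fun h => hwf.ne h.1.symm) (fun h => ?_)
        exact hyw h.2
      exact hyw (hK.leaf w hwK y (hBc.closed _ hfB y ⟨hyU, hyX⟩ hadj) hadj)
    -- A `K₂` with `w` as its pendant is read with core and pendant exchanged.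
    by_cases hbad : ∃ i ∈ K, w = f i ∧ K = {i}
    · obtain ⟨i, hi, rfl, rfl⟩ := hbad
      have hadj := hK.pendant.adj i rfl
      have hcor : IsCorona (G.deleteEdges {s(f i, a)}) B {f i} (fun _ => i) := by
        refine ⟨⟨_, rfl⟩, ?_, ⟨by simp, ?_, ?_⟩, ?_, ?_⟩
        · rw [hK.eq]
          simp [Set.pair_comm]
        · rintro _ rfl h
          exact hadj.ne h
        · rintro _ rfl
          exact hadj.symm
        · rintro _ rfl y hy hiy
          rw [hK.eq, Set.image_singleton] at hy
          rcases hy with rfl | rfl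
          · exact absurd hiy (SimpleGraph.irrefl _)
          · rfl
        · rintro _ rfl
          exact ⟨id, by simp⟩
      refine ⟨_, _, hcor, key _ _ hcor, ?_⟩
      rintro j - h
      exact absurd h hadj.ne'
    · push Not at hbad
      exact ⟨K, f, hK, key K f hK, hbad⟩

theorem ncard_edgeSet_deleteEdge_lt [Finite V] (h : G.Adj w a) :
    (G.deleteEdges {s(w, a)}).edgeSet.ncard < G.edgeSet.ncard := by
  rw [SimpleGraph.edgeSet_deleteEdges]
  exact Set.ncard_sdiff_singleton_lt_of_mem h

/-- A connected set `U` that satisfies the sun bound strictly, is not a sun and has no path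
cover, while everything smaller that satisfies the sun bound has one. -/
structure IsMinimalCounterexample (G : SimpleGraph V) (U : Set V) : Prop where
  isComp : IsComp G U U
  not_sun : ¬ IsSunSet G U
  bound : ∀ X ⊆ U, X.Nonempty → (sunSets G (U \ X)).ncard + 1 ≤ 2 * X.ncard
  not_pathCover : ¬ PathCover G U
  ih : ∀ G' ≤ G, ∀ U' ⊆ U, U'.ncard + G'.edgeSet.ncard < U.ncard + G.edgeSet.ncard →
    SunBound G' U' → PathCover G' U'

/-- By minimality, deleting `wa` breaks the sun bound at some `X`. If `X` is nonempty, strictness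
forces two new suns `A ∋ a` and `B ∋ w`, and any entry from `X` at which `B ∪ A` hangs would give a
cover. Hence `w` is a pendant of a corona `B` that no edge joins to `X`, so `B` is a component of
all of `U`. If `X` is empty, some component of `U` has become a sun. -/
theorem IsMinimalCounterexample.exists_of_deleteEdge [Finite V]
    (h : IsMinimalCounterexample G U) (hw : w ∈ U) (ha : a ∈ U) (hwa : G.Adj w a)
    (hpend : ∀ v ∈ U, G.Adj w v → ∃ y ∈ U, y ≠ w ∧ G.Adj v y)
    (hdeg : ∃ z ∈ U, z ≠ a ∧ G.Adj w z) :
    (∃ A ∈ sunSets (G.deleteEdges {s(w, a)}) U, a ∈ A ∧ w ∉ A) ∨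
    ∃ B K f i, IsComp (G.deleteEdges {s(w, a)}) U B ∧
      IsCorona (G.deleteEdges {s(w, a)}) B K f ∧ i ∈ K ∧ w = f i ∧ K ≠ {i} ∧ a ∉ B := by
  have hlt := ncard_edgeSet_deleteEdge_lt hwa
  have hle := deleteEdge_le G w a
  set G' := G.deleteEdges {s(w, a)} with hG'
  have hnb : ¬ SunBound G' U := fun hb => h.not_pathCover
    ((h.ih G' hle U subset_rfl (by omega) hb).mono hle)
  simp only [SunBound] at hnb
  push Not at hnb
  obtain ⟨X, hXU, hX⟩ := hnb
  -- a corona containing `w` but not `a` that `X` does not separate is a component of `U`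
  have hQ : ∀ B K f, IsComp G' (U \ X) B → IsCorona G' B K f → w ∈ B → w ∉ K →
      (∀ i ∈ K, w = f i → K ≠ {i}) → a ∉ B → (∀ x ∈ X, ∀ p ∈ B, ¬ G.Adj x p) →
      ∃ B K f i, IsComp G' U B ∧ IsCorona G' B K f ∧ i ∈ K ∧ w = f i ∧ K ≠ {i} ∧ a ∉ B := by
    intro B K f hB hK hwB hwK hne haB hno
    obtain ⟨i, hi, hwi | hwi⟩ := hK.mem_iff.mp hwB
    · exact absurd (hwi ▸ hi) hwK
    · refine ⟨B, K, f, i, ?_, hK, hi, hwi, hne i hi hwi, haB⟩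
      exact hB.congr (hB.subset.trans Set.sdiff_subset)
        (fun x hx y hy hxy => ⟨⟨hy, fun hyX => hno y hyX x hx (hle hxy.symm)⟩, hxy⟩)
        fun _ _ _ _ h => h
  rcases X.eq_empty_or_nonempty with rfl | hXne
  · rw [Set.sdiff_empty, Set.ncard_empty, mul_zero, Set.ncard_pos] at hX
    obtain ⟨C, hC⟩ := hX
    by_cases hwC : w ∈ C
    · by_cases haC : a ∈ C
      · exfalso
        have hclosed : ∀ x ∈ C, ∀ y ∈ U, G.Adj x y → y ∈ C := by
          intro x hx y hy hxy
          by_cases h1 : x = w ∧ y = a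
          · exact h1.2 ▸ haC
          by_cases h2 : x = a ∧ y = w
          · exact h2.2 ▸ hwC
          exact hC.1.closed x hx y hy (deleteEdge_adj hxy h1 h2)
        obtain rfl := h.isComp.minimal C hC.1.subset hC.1.nonempty hclosed
        rcases hC.2 with ⟨v, rfl⟩ | ⟨K, f, hK⟩
        · exact hwa.ne (Eq.trans (show w = v from hwC) (show a = v from haC).symm)
        -- Restoring `wa` at a pendant vertex would create a cover. So both ends lie in the core,
        -- where an extra edge keeps the sun a sun.
        · have hpc : ∀ i ∈ K, ∀ x ∈ C, ∀ y ∈ C, y = f i → G.Adj y x → ¬ G'.Adj y x → False := by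
            rintro i hi x hx _ hy rfl hadj hnadj
            refine h.not_pathCover (hK.pathCover_of_adj hle hi hx ?_ hadj)
            rintro rfl
            exact hnadj (hK.pendant.adj x hi).symm
          have hnwa : ¬ G'.Adj w a := not_deleteEdge_adj G w a
          have hw' : w ∈ K := by
            obtain ⟨i, hi, rfl | hwi⟩ := hK.mem_iff.mp hwC
            · exact hi
            · exact (hpc i hi a haC w hwC hwi hwa hnwa).elim
          have ha' : a ∈ K := by
            obtain ⟨i, hi, rfl | hai⟩ := hK.mem_iff.mp haC
            · exact hi
            · exact (hpc i hi w hwC a haC hai hwa.symm fun h => hnwa h.symm).elim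
          refine h.not_sun (Or.inr ⟨K, f, hK.nonempty, hK.eq, ⟨hK.pendant.inj, hK.pendant.notMem,
            fun k hk => hle (hK.pendant.adj k hk)⟩, ?_, fun k hk =>
              (hK.critical k hk).congr fun _ _ _ _ h => hle h⟩)
          intro k hk y hy hky
          refine hK.leaf k hk y hy (deleteEdge_adj hky ?_ ?_)
          · rintro ⟨h1, -⟩
            exact hK.pendant.notMem k hk (h1 ▸ hw')
          · rintro ⟨h1, -⟩
            exact hK.pendant.notMem k hk (h1 ▸ ha')
      · right
        have hC' : C ∈ sunSets G' (U \ ∅) := by rwa [Set.sdiff_empty]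
        rcases sun_structure hw hpend hdeg hC' hwC haC with ⟨-, x, hx, -⟩ | ⟨K, f, hK, h1, h2⟩
        · exact hx.elim
        · exact hQ C K f hC'.1 hK hwC (fun hwK => by obtain ⟨x, hx, -⟩ := h1 hwK; exact hx) h2 haC
            (fun x hx => hx.elim)
    · by_cases haC : a ∈ C
      · exact Or.inl ⟨C, hC, haC, hwC⟩
      · exfalso
        have hC' : C ∈ sunSets G U :=
          mem_sunSets_of_deleteEdge hC fun h => h.2.2.elim hwC haC
        obtain ⟨x, hx⟩ := hC'.1.nonempty
        obtain rfl := hC'.1.eq_of_mem h.isComp hx (hC'.1.subset hx)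
        exact hwC hw
  · right
    have hb := h.bound X hXU hXne
    have hup := ncard_sunSets_deleteEdge_le G (U \ X) w a
    rw [← hG'] at hup
    obtain ⟨A, hA, B, hB, hAB, haA, hwB⟩ :=
      exists_pair_of_ncard_sunSets (G := G) (U := U \ X) (w := w) (a := a) (by rw [← hG']; omega)
    have hdis : Disjoint B A := hB.1.disjoint hA.1 hAB.symm
    have haB : a ∉ B := fun haB => Set.disjoint_left.mp hdis haB haA
    have hAh : Hanging G 1 A a := (hA.2.hanging haA).mono hle
    have hadjB : ∀ x ∈ B, ∀ y ∈ B, (G'.Adj x y ↔ G.Adj x y) := fun x hx y hy =>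
      deleteEdge_adj_iff (fun h => haB (h.2 ▸ hy)) (fun h => haB (h.1 ▸ hx))
    -- an entry into `B` from `X` would give a path cover
    have hmerge : ∀ x ∈ X, ∀ p ∈ B, G.Adj x p → ¬ Hanging G 1 (B ∪ A) p := by
      intro x hx p hp hxp hBA
      refine h.not_pathCover (pathCover_of_merged hle hXU hA hB hAB (by omega) hx hp hxp hBA ?_ ?_)
      · intro S hS hne
        have hS1 : S ⊆ sunSets G (U \ X) := by
          intro C hC
          obtain ⟨hC1, hC2⟩ := hS hC
          refine mem_sunSets_of_deleteEdge hC1 ?_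
          rintro ⟨-, -, hwC | haC⟩
          · exact hC2 (Or.inr (hC1.1.eq_of_mem hB.1 hwC hwB))
          · exact hC2 (Or.inl (hC1.1.eq_of_mem hA.1 haC haA))
        have hS2 := Set.ncard_le_ncard (subset_sunSets_linkers le_rfl hS1)
        rcases (linkers G X S).eq_empty_or_nonempty with he | hlne
        · exfalso
          obtain ⟨C, hC⟩ := hne
          have hC' := subset_sunSets_linkers le_rfl hS1 hC
          rw [he, Set.sdiff_empty] at hC'
          obtain ⟨y, hy⟩ := hC'.1.nonempty
          obtain rfl := hC'.1.eq_of_mem h.isComp hy (hC'.1.subset hy)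
          exact h.not_sun hC'.2
        · have := h.bound _ ((linkers_subset G X S).trans hXU) hlne
          omega
      · intro C hC hCs
        have hCU : C ⊆ U := hC.subset.trans Set.sdiff_subset
        refine h.ih G' hle C hCU ?_ fun Y hY => ?_
        · have := Set.ncard_le_ncard hCU
          omega
        -- At least `2|X| + 1` suns are present, and restoring the edge costs at most two: with the
        -- strict bound at `X ∪ Y`, exactly `2|Y|` remain available for `C`.
        · have h1 := ncard_sunSets_add_le hC hCs hY
          have h2 := ncard_sunSets_deleteEdge_le G (U \ (X ∪ Y)) w a
          have h3 := h.bound (X ∪ Y) (Set.union_subset hXU (hY.trans hCU))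
            (hXne.mono Set.subset_union_left)
          have h4 := Set.ncard_union_le X Y
          rw [← hG'] at h2
          omega
    rcases sun_structure hw hpend hdeg hB hwB haB with ⟨rfl, x, hx, hxw⟩ | ⟨K, f, hK, h1, h2⟩
    · refine (hmerge x hx w rfl hxw ?_).elim
      rw [Set.singleton_union]
      exact (hAh.cons (Set.disjoint_left.mp hdis rfl) hwa).weaken (by norm_num)
    · have hK' := hK.congr hadjB
      have hwK : w ∉ K := fun hwK => by
        obtain ⟨x, hx, hxf⟩ := h1 hwK
        exact hmerge x hx _ (hK.map_mem hwK) hxf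
          (hK'.hanging_union (hK.map_mem hwK) hwB (fun _ => rfl) h2 hAh hwa hdis)
      refine hQ B K f hB.1 hK hwB hwK h2 haB fun x hx p hp hxp => ?_
      exact hmerge x hx p hp hxp
        (hK'.hanging_union hp hwB (fun h => absurd h hwK) h2 hAh hwa hdis)

/-- Otherwise the dichotomy of `exists_of_deleteEdge` applies to each edge at `w`. Two far-end suns
would violate the strict bound at `{w}`, so some edge `wa` leaves `w` as a pendant of a corona `B`,
with neighbours `i` and `a` only. The dichotomy for the edge `wi` then fails by parity or exhibits
`U` as two coronas sharing `w`, which has a cover. -/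
theorem IsMinimalCounterexample.exists_pendant [Finite V]
    (h : IsMinimalCounterexample G U) (hw : w ∈ U)
    (hdeg : ∃ y ∈ U, ∃ z ∈ U, y ≠ z ∧ G.Adj w y ∧ G.Adj w z) :
    ∃ v ∈ U, G.Adj w v ∧ ∀ y ∈ U, G.Adj v y → y = w := by
  by_contra hno
  have hpend : ∀ v ∈ U, G.Adj w v → ∃ y ∈ U, y ≠ w ∧ G.Adj v y := by
    intro v hv hwv
    by_contra! hc
    exact hno ⟨v, hv, hwv, fun y hy hvy => by_contra fun hne => hc y hy hne hvy⟩
  obtain ⟨y, hy, z, hz, hyz, hwy, hwz⟩ := hdeg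
  have hdeg' : ∀ a, ∃ z ∈ U, z ≠ a ∧ G.Adj w z := by
    intro a
    by_cases hya : y = a
    · exact ⟨z, hz, hya ▸ hyz.symm, hwz⟩
    · exact ⟨y, hy, hya, hwy⟩
  have hdich := fun a (ha : a ∈ U) (hwa : G.Adj w a) =>
    h.exists_of_deleteEdge hw ha hwa hpend (hdeg' a)
  -- a sun component at the far end of an edge at `w` is a component of `U \ {w}`
  have hcomp : ∀ a A, A ∈ sunSets (G.deleteEdges {s(w, a)}) U → w ∉ A →
      A ∈ sunSets G (U \ {w}) := by
    intro a A hA hwA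
    have hadj : ∀ x ∈ A, ∀ y, y ≠ w → ((G.deleteEdges {s(w, a)}).Adj x y ↔ G.Adj x y) :=
      fun x hx y hy => deleteEdge_adj_iff (fun h => hwA (h.1 ▸ hx)) (fun h => hy h.2)
    have hne : ∀ x ∈ A, x ≠ w := fun x hx h => hwA (h ▸ hx)
    refine ⟨hA.1.congr (fun x hx => ⟨hA.1.subset hx, hne x hx⟩) (fun x hx y hy hxy =>
      ⟨hy.1, (hadj x hx y hy.2).mpr hxy⟩) (fun x hx y hy => (hadj x hx y (hne y hy)).mp),
      hA.2.congr fun x hx y hy => hadj x hx y (hne y hy)⟩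
  have hcorona : ∃ a ∈ U, G.Adj w a ∧ ∃ B K f i, IsComp (G.deleteEdges {s(w, a)}) U B ∧
      IsCorona (G.deleteEdges {s(w, a)}) B K f ∧ i ∈ K ∧ w = f i ∧ K ≠ {i} ∧ a ∉ B := by
    rcases hdich y hy hwy with ⟨A, hA, hyA, hwA⟩ | hQ
    · rcases hdich z hz hwz with ⟨A', hA', hzA', hwA'⟩ | hQ
      · exfalso
        have hne : A ≠ A' := by
          rintro rfl
          exact hwA (hA.1.closed z hzA' w hw (deleteEdge_adj hwz.symm (fun h => hwz.ne h.1.symm)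
            (fun h => hyz h.1.symm)))
        have h1 := Set.ncard_le_ncard (s := {A, A'}) (t := sunSets G (U \ {w}))
          (by rintro C (rfl | rfl); exacts [hcomp _ _ hA hwA, hcomp _ _ hA' hwA'])
        have h2 := h.bound {w} (by simpa using hw) ⟨w, rfl⟩
        rw [Set.ncard_pair hne] at h1
        rw [Set.ncard_singleton] at h2
        omega
      · exact ⟨z, hz, hwz, hQ⟩
    · exact ⟨y, hy, hwy, hQ⟩
  obtain ⟨a, ha, hwa, B, K, f, i, hB, hK, hi, rfl, hKi, haB⟩ := hcorona
  have hwi := deleteEdge_le _ _ _ (hK.pendant.adj i hi).symm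
  have hiB := hK.subset hi
  have hwB := hK.map_mem hi
  have hia : i ≠ a := fun h => haB (h ▸ hiB)
  have hiU := hB.subset hiB
  -- the only neighbours of `f i` are `i` and `a`
  have hnbr : ∀ y ∈ U, G.Adj (f i) y → y = i ∨ y = a := by
    intro y hy hwy
    by_contra! hc
    have hadj := deleteEdge_adj (w := f i) (a := a) hwy (fun h => hc.2 h.2)
      (fun h => hwa.ne h.1)
    exact hc.1 (hK.leaf i hi y (hB.closed _ hwB y hy hadj) hadj)
  have hBout : ∀ x ∈ B, x ≠ f i → ∀ y ∈ U, G.Adj x y → y ∈ B := fun x hx hxw y hy hxy =>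
    hB.closed x hx y hy (deleteEdge_adj hxy (fun h => hxw h.1) (fun h => haB (h.1 ▸ hx)))
  have hBclosed : ∀ x ∈ B \ {f i}, ∀ y ∈ U, (G.deleteEdges {s(f i, i)}).Adj x y →
      y ∈ B \ {f i} := by
    rintro x ⟨hx, hxw⟩ y hy hxy
    have hxy' := deleteEdge_le _ _ _ hxy
    refine ⟨hBout x hx hxw y hy hxy', ?_⟩
    rintro rfl
    rcases hnbr x (hB.subset hx) hxy'.symm with rfl | rfl
    · exact not_deleteEdge_adj _ _ _ hxy.symm
    · exact haB hx
  rcases hdich i hiU hwi with ⟨A, hA, hiA, hwA⟩ | ⟨B', K', f', i', hB', hK', hi', hwi', -, hiB'⟩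
  · have h1 : A ⊆ B \ {f i} := hA.1.subset_of_closed hBclosed hiA ⟨hiB, hwi.ne'⟩
    have h2 : B ⊆ insert (f i) A := by
      refine hB.subset_of_closed ?_ hiB (Or.inr hiA)
      rintro x hx y hy hxy
      by_cases hyw : y = f i
      · exact Or.inl hyw
      rcases hx with rfl | hx
      · rcases hnbr y hy (deleteEdge_le _ _ _ hxy) with rfl | rfl
        · exact Or.inr hiA
        · exact absurd hxy (not_deleteEdge_adj _ _ _)
      · exact Or.inr (hA.1.closed x hx y hy (deleteEdge_adj (deleteEdge_le _ _ _ hxy)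
          (fun h => hwA (h.1 ▸ hx)) (fun h => hyw h.2)))
    have h3 : B = insert (f i) A := by
      refine h2.antisymm ?_
      rintro x (rfl | hx)
      exacts [hwB, (h1 hx).1]
    -- Coronas have even order, so `A`, one vertex short of `B`, is a single vertex and `B` is the
    -- excluded `K₂`.
    have h4 := hK.ncard_eq
    rw [h3, Set.ncard_insert_of_notMem hwA] at h4
    rcases hA.2 with ⟨v, rfl⟩ | ⟨L, g, hL⟩
    · rw [Set.ncard_singleton] at h4
      obtain ⟨k, rfl⟩ := Set.ncard_eq_one.mp (show K.ncard = 1 by omega)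
      obtain rfl : i = k := hi
      exact hKi rfl
    · have := hL.ncard_eq
      omega
  · have hwB' : f i ∈ B' := hwi' ▸ hK'.map_mem hi'
    obtain rfl : i' = a := by
      have hadj : G.Adj (f i) i' := by
        rw [hwi']
        exact (deleteEdge_le _ _ _ (hK'.pendant.adj i' hi')).symm
      rcases hnbr i' (hB'.subset (hK'.subset hi')) hadj with h1 | h1
      · exact absurd (h1 ▸ hK'.subset hi') hiB'
      · exact h1
    have hdis : Disjoint (B \ {f i}) B' := by
      rw [Set.disjoint_left]
      intro x hx hxB'
      exact (hB'.subset_of_closed hBclosed hxB' hx hwB').2 rfl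
    have hU : U = B ∪ B' := by
      symm
      refine h.isComp.minimal _ (Set.union_subset hB.subset hB'.subset) ⟨_, Or.inl hwB⟩ ?_
      intro x hx y hy hxy
      by_cases hxw : x = f i
      · subst hxw
        rcases hnbr y hy hxy with rfl | rfl
        · exact Or.inl hiB
        · exact Or.inr (hK'.subset hi')
      · rcases hx with hx | hx
        · exact Or.inl (hBout x hx hxw y hy hxy)
        · refine Or.inr (hB'.closed x hx y hy (deleteEdge_adj hxy (fun h => hxw h.1) ?_))
          rintro ⟨rfl, -⟩
          exact hiB' hx
    refine h.not_pathCover ?_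
    have hR := (hK.pathCover_erase hi).mono (deleteEdge_le _ _ _)
    have hR' := (hK'.pathCover_erase hi').mono (deleteEdge_le _ _ _)
    have hBe := hK.eq_pair_union hi
    have hBd := hK.pendant.disjoint_erase hi
    have hBe' := hK'.eq_pair_union hi'
    have hBd' := hK'.pendant.disjoint_erase hi'
    rw [← hwi'] at hBe' hBd'
    set R := K \ {i} ∪ f '' (K \ {i})
    set R' := K' \ {i'} ∪ f' '' (K' \ {i'})
    have e1 : R ⊆ B \ {f i} := fun x hx => ⟨hBe ▸ Or.inr hx, by
      rintro rfl
      exact Set.disjoint_left.mp hBd (Or.inr rfl) hx⟩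
    have e2 : R' ⊆ B' := hBe' ▸ Set.subset_union_right
    have c1 := (hanging_singleton G i').union hR' (by
      rw [Set.disjoint_singleton_left]
      exact Set.disjoint_left.mp hBd' (Or.inl rfl))
    have c2 := (hanging_singleton G i).union hR (by
      rw [Set.disjoint_singleton_left]
      exact Set.disjoint_left.mp hBd (Or.inl rfl))
    have c3 : {i} ∪ R ⊆ B \ {f i} := Set.union_subset (by simpa using ⟨hiB, hwi.ne'⟩) e1
    have c4 : {i'} ∪ R' ⊆ B' := Set.union_subset (by simpa using hK'.subset hi') e2
    -- The path `i`, `f i`, `i'` passes through the shared vertex; criticality covers both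
    -- remainders.
    have c5 := c2.link c1 (x := f i) (hdis.mono c3 c4) (fun h => (c3 h).2 rfl) (by
      rintro (h | h)
      · exact hwa.ne h
      · exact Set.disjoint_left.mp hBd' (Or.inr rfl) h) hwi hwa
    convert c5 using 1
    rw [hU, hBe, hBe']
    ext x
    simp only [Set.mem_union, Set.mem_insert_iff, Set.mem_singleton_iff]
    tauto

end Kaneko

/-! ### Kaneko's theorem. -/

section KanekoTheorem

variable {V : Type*} {G : SimpleGraph V} {C U W X : Set V} {f : V → V}

/-- Attaching the pendant vertices to a factor-critical component of `W \ X` gives a sun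
component. -/
theorem union_image_mem_sunSets (hU : U = W ∪ f '' W) (hf : IsPendantMap G W f)
    (hleaf : ∀ w ∈ W, ∀ y ∈ U, G.Adj (f w) y → y = w) (hXW : X ⊆ W) (hC : IsComp G (W \ X) C)
    (hcrit : ∀ c ∈ C, HasMatching G (C \ {c})) : C ∪ f '' C ∈ sunSets G (U \ X) := by
  have hCW : C ⊆ W := hC.subset.trans Set.sdiff_subset
  have hWU : W ⊆ U := hU ▸ Set.subset_union_left
  have hfU : ∀ w ∈ W, f w ∈ U := fun w hw => hU ▸ Or.inr ⟨w, hw, rfl⟩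
  refine ⟨⟨hC.nonempty.mono Set.subset_union_left, ?_, ?_, ?_⟩, Or.inr ⟨C, f, hC.nonempty, rfl,
    hf.subset hCW, ?_, hcrit⟩⟩
  · rintro x (hx | ⟨c, hc, rfl⟩)
    · exact ⟨hWU (hCW hx), (hC.subset hx).2⟩
    · exact ⟨hfU c (hCW hc), fun h => hf.notMem c (hCW hc) (hXW h)⟩
  · rintro x (hx | ⟨c, hc, rfl⟩) y ⟨hyU, hyX⟩ hxy
    · rcases hU ▸ hyU with hyW | ⟨k, hk, rfl⟩
      · exact Or.inl (hC.closed x hx y ⟨hyW, hyX⟩ hxy)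
      · obtain rfl := hleaf k hk x (hWU (hCW hx)) hxy.symm
        exact Or.inr ⟨x, hx, rfl⟩
    · obtain rfl := hleaf c (hCW hc) y hyU hxy
      exact Or.inl hc
  · intro S hS hne hSc
    have hmem : ∀ c ∈ C, (c ∈ S ↔ f c ∈ S) := by
      intro c hc
      have hcU : c ∈ U \ X := ⟨hWU (hCW hc), (hC.subset hc).2⟩
      have hfcU : f c ∈ U \ X :=
        ⟨hfU c (hCW hc), fun h => hf.notMem c (hCW hc) (hXW h)⟩
      exact ⟨fun h => hSc c h _ hfcU (hf.adj c (hCW hc)),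
        fun h => hSc _ h c hcU (hf.adj c (hCW hc)).symm⟩
    have hSC : S ∩ C = C := by
      refine hC.minimal _ Set.inter_subset_right ?_ ?_
      · obtain ⟨s, hs⟩ := hne
        rcases hS hs with hsC | ⟨c, hc, rfl⟩
        · exact ⟨s, hs, hsC⟩
        · exact ⟨c, (hmem c hc).mpr hs, hc⟩
      · rintro x ⟨hxS, hxC⟩ y hy hxy
        exact ⟨hSc x hxS y ⟨hWU hy.1, hy.2⟩ hxy, hC.closed x hxC y hy hxy⟩
    refine hS.antisymm ?_
    rintro x (hx | ⟨c, hc, rfl⟩)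
    · exact Set.inter_eq_right.mp hSC hx
    · exact (hmem c hc).mp (Set.inter_eq_right.mp hSC hc)
  · rintro k hk y (hy | ⟨c, hc, rfl⟩) hky
    · exact hleaf k (hCW hk) y (hWU (hCW hy)) hky
    · exact hleaf k (hCW hk) _ (hfU c (hCW hc)) hky

/-- The pendants of `X` become isolated vertices, and each critical component with its pendants is a
corona; meeting `W` or not tells the two kinds apart. -/
theorem ncard_add_ncard_critical_le [Finite V] (hU : U = W ∪ f '' W) (hf : IsPendantMap G W f)
    (hleaf : ∀ w ∈ W, ∀ y ∈ U, G.Adj (f w) y → y = w) (hXW : X ⊆ W) :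
    X.ncard + {C | IsComp G (W \ X) C ∧ ∀ c ∈ C, HasMatching G (C \ {c})}.ncard ≤
      (sunSets G (U \ X)).ncard := by
  set F := {C | IsComp G (W \ X) C ∧ ∀ c ∈ C, HasMatching G (C \ {c})} with hF
  have hCW : ∀ C ∈ F, C ⊆ W := fun C hC => hC.1.subset.trans Set.sdiff_subset
  have h1 : Set.InjOn (fun x => ({f x} : Set V)) X := fun x hx y hy h =>
    hf.inj (hXW hx) (hXW hy) (Set.singleton_injective h)
  have hinter : ∀ C ∈ F, (C ∪ f '' C) ∩ W = C := by
    intro C hC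
    ext x
    constructor
    · rintro ⟨hx | ⟨c, hc, rfl⟩, hxW⟩
      · exact hx
      · exact absurd hxW (hf.notMem c (hCW C hC hc))
    · exact fun hx => ⟨Or.inl hx, hCW C hC hx⟩
  have h2 : Set.InjOn (fun C => C ∪ f '' C) F := by
    intro C hC D hD h
    rw [← hinter C hC, ← hinter D hD]
    exact congrArg (· ∩ W) h
  rw [← h1.ncard_image, ← h2.ncard_image, ← Set.ncard_union_eq]
  · refine Set.ncard_le_ncard ?_ (Set.toFinite _)
    rintro _ (⟨x, hx, rfl⟩ | ⟨C, hC, rfl⟩)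
    · have hxW := hXW hx
      refine ⟨isComp_singleton ⟨hU ▸ Or.inr ⟨x, hxW, rfl⟩, fun h => hf.notMem x hxW (hXW h)⟩ ?_,
        Or.inl ⟨_, rfl⟩⟩
      rintro y ⟨hyU, hyX⟩ hxy
      exact hyX (hleaf x hxW y hyU hxy ▸ hx)
    · exact union_image_mem_sunSets hU hf hleaf hXW hC.1 hC.2
  · rw [Set.disjoint_left]
    rintro _ ⟨x, hx, rfl⟩ ⟨C, hC, h⟩
    obtain ⟨c, hc⟩ := hC.1.nonempty
    have hcx : c ∈ ({f x} : Set V) := by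
      rw [← show C ∪ f '' C = {f x} from h]
      exact Or.inl hc
    exact hf.notMem x (hXW hx) (hcx ▸ hCW C hC hc)

theorem not_isMinimalCounterexample [Finite V] (G : SimpleGraph V) (U : Set V) :
    ¬ IsMinimalCounterexample G U := by
  intro h
  have huniq : ∀ C ∈ sunSets G U, False := by
    intro C hC
    obtain ⟨x, hx⟩ := hC.1.nonempty
    obtain rfl := hC.1.eq_of_mem h.isComp hx (hC.1.subset hx)
    exact h.not_sun hC.2
  have hnbr : ∀ v ∈ U, ∃ y ∈ U, G.Adj v y := by
    intro v hv
    by_contra! hc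
    exact huniq {v} ⟨isComp_singleton hv hc, Or.inl ⟨v, rfl⟩⟩
  let W := {w ∈ U | ∃ y ∈ U, ∃ z ∈ U, y ≠ z ∧ G.Adj w y ∧ G.Adj w z}
  have hpend : ∀ w : V, ∃ v, w ∈ W → v ∈ U ∧ G.Adj w v ∧ ∀ y ∈ U, G.Adj v y → y = w := by
    intro w
    by_cases hw : w ∈ W
    · obtain ⟨v, hv⟩ := h.exists_pendant hw.1 hw.2
      exact ⟨v, fun _ => hv⟩
    · exact ⟨w, fun h => absurd h hw⟩
  choose f hf using hpend
  have hWU : W ⊆ U := fun w hw => hw.1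
  have hleaf : ∀ w ∈ W, ∀ y ∈ U, G.Adj (f w) y → y = w := fun w hw => (hf w hw).2.2
  have hfW : IsPendantMap G W f := by
    refine ⟨fun w hw w' hw' he => ?_, fun w hw hfw => ?_, fun w hw => (hf w hw).2.1⟩
    · exact hleaf w' hw' w (hWU hw) (he ▸ (hf w hw).2.1.symm)
    · obtain ⟨-, y, hy, z, hz, hyz, hwy, hwz⟩ := hfw
      exact hyz ((hleaf w hw y hy hwy).trans (hleaf w hw z hz hwz).symm)
  have hUW : U = W ∪ f '' W := by
    refine Set.Subset.antisymm (fun v hv => ?_) ?_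
    · by_contra hv'
      rw [Set.mem_union, not_or] at hv'
      obtain ⟨y, hy, hvy⟩ := hnbr v hv
      have hvu : ∀ z ∈ U, G.Adj v z → z = y := fun z hz hvz => by_contra fun hne =>
        hv'.1 ⟨hv, z, hz, y, hy, hne, hvz, hvy⟩
      by_cases hyW : y ∈ W
      · have hne : v ≠ f y := fun he => hv'.2 ⟨y, hyW, he.symm⟩
        -- Two pendants at `y` are two suns left by one vertex, against the strict bound.
        have hsub : {{v}, {f y}} ⊆ sunSets G (U \ {y}) := by
          rintro _ (rfl | rfl)
          · exact ⟨isComp_singleton ⟨hv, hvy.ne⟩ fun z hz hvz => hz.2 (hvu z hz.1 hvz),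
              Or.inl ⟨v, rfl⟩⟩
          · exact ⟨isComp_singleton ⟨(hf y hyW).1, (hf y hyW).2.1.ne'⟩ fun z hz hyz =>
              hz.2 (hleaf y hyW z hz.1 hyz), Or.inl ⟨_, rfl⟩⟩
        have h1 := Set.ncard_le_ncard hsub
        have h2 := h.bound {y} (by simpa using hy) ⟨y, rfl⟩
        rw [Set.ncard_pair fun he => hne (Set.singleton_injective he)] at h1
        rw [Set.ncard_singleton] at h2
        omega
      · have hyu : ∀ z ∈ U, G.Adj y z → z = v := fun z hz hyz => by_contra fun hne =>
          hyW ⟨hy, z, hz, v, hv, hne, hyz, hvy.symm⟩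
        have hpair : ({v, y} : Set V) = U := by
          refine h.isComp.minimal _ ?_ ⟨v, Or.inl rfl⟩ ?_
          · rintro _ (rfl | rfl) <;> assumption
          · rintro _ (rfl | rfl) z hz hz'
            · exact Or.inr (hvu z hz hz')
            · exact Or.inl (hyu z hz hz')
        refine h.not_sun (Or.inr ⟨{v}, fun _ => y, ⟨v, rfl⟩, ?_, ⟨by simp, ?_, ?_⟩, ?_, ?_⟩)
        · rw [← hpair]
          simp [Set.pair_comm]
        · rintro _ rfl hyv
          exact hvy.ne' hyv
        · rintro _ rfl
          exact hvy
        · rintro _ rfl z hz hyz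
          exact hyu z hz hyz
        · rintro _ rfl
          exact ⟨id, by simp⟩
    · rintro v (hv | ⟨w, hw, rfl⟩)
      · exact hWU hv
      · exact (hf w hw).1
  rcases hasMatching_or_exists_lt_critical G W with hM | ⟨X, hXW, hX⟩
  · exact h.not_pathCover (hUW ▸ hfW.pathCover hM)
  · have hle := ncard_add_ncard_critical_le hUW hfW hleaf hXW
    rcases X.eq_empty_or_nonempty with rfl | hne
    · rw [(Set.sdiff_empty : U \ ∅ = U)] at hle
      obtain ⟨C, hC⟩ := (Set.ncard_pos).mp (show 0 < (sunSets G U).ncard by omega)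
      exact huniq C hC
    · have := h.bound X (hXW.trans hWU) hne
      omega

/-- **Kaneko's theorem**, the sufficiency of the sun condition. -/
theorem SunBound.pathCover [Finite V] (hb : SunBound G U) : PathCover G U := by
  induction hn : U.ncard + G.edgeSet.ncard using Nat.strong_induction_on generalizing G U with
  | _ n ih =>
    have ih' : ∀ G' ≤ G, ∀ U' ⊆ U, U'.ncard + G'.edgeSet.ncard < U.ncard + G.edgeSet.ncard →
        SunBound G' U' → PathCover G' U' := fun G' _ U' _ hlt hb' => ih _ (hn ▸ hlt) hb' rfl
    rcases U.eq_empty_or_nonempty with rfl | hne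
    · exact .empty
    by_contra hP
    -- That `U` is a component of `U \ X` encodes both that `X` is empty and that `U` is connected.
    -- The empty set is itself tight, which gives connectedness below.
    have htight : ∀ X ⊆ U, (sunSets G (U \ X)).ncard = 2 * X.ncard → IsComp G (U \ X) U := by
      intro X hX heq
      by_contra hc
      refine hP (pathCover_of_tight hb hX heq fun C hC hbC => ih' G le_rfl C ?_ ?_ hbC)
      · exact hC.subset.trans Set.sdiff_subset
      · have hCU : C ⊂ U := (hC.subset.trans Set.sdiff_subset).ssubset_of_ne
          fun he => hc (he ▸ hC)
        have := Set.ncard_lt_ncard hCU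
        omega
    have h0 := hb ∅ (Set.empty_subset _)
    rw [Set.ncard_empty, mul_zero, Nat.le_zero] at h0
    have hcomp := htight ∅ (Set.empty_subset _) (by simpa using h0)
    rw [Set.sdiff_empty] at h0 hcomp
    refine not_isMinimalCounterexample G U ⟨hcomp, fun hs => ?_, fun X hX hXne => ?_, hP, ih'⟩
    · rw [Set.ncard_eq_zero] at h0
      exact (h0 ▸ ⟨hcomp, hs⟩ : U ∈ (∅ : Set (Set V)))
    · refine Nat.lt_of_le_of_ne (hb X hX) fun heq => ?_
      obtain ⟨x, hx⟩ := hXne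
      exact ((htight X hX heq).subset (hX hx)).2 hx

end KanekoTheorem

/-! ### From vertex sets back to graphs, factors and suns. -/

section Translation

variable {V W : Type*} {G : SimpleGraph V} {S : SimpleGraph W} {C K X U : Set V} {f : V → V}

theorem exists_iso_of_range_eq {W' : Type*} {T : SimpleGraph W'} (φ : S ↪g G) (ψ : T ↪g G)
    (h : Set.range φ = Set.range ψ) : Nonempty (S ≃g T) := by
  have e : Nonempty (G.induce (Set.range φ) ≃g T) := by
    rw [h]
    exact ⟨ψ.isoInduceRange.symm⟩
  exact ⟨φ.isoInduceRange.trans e.some⟩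

/-- A path cover gives a path factor. -/
theorem PathCover.exists_le (h : PathCover G U) : ∃ H ≤ G,
    (∀ x y, H.Adj x y → x ∈ U ∧ y ∈ U) ∧ ∀ x ∈ U, ∃ n, 3 ≤ n ∧
      ∃ φ : SimpleGraph.pathGraph n ↪g H, x ∈ Set.range φ ∧
        ∀ y ∈ Set.range φ, ∀ z, H.Adj y z → z ∈ Set.range φ := by
  induction h with
  | empty => exact ⟨⊥, bot_le, by simp, by simp⟩
  | cons l S hl hc h3 hd _ ih =>
    obtain ⟨H, hHG, hHS, hH⟩ := ih
    let ι : Fin l.length ↪ V := ⟨l.get, List.nodup_iff_injective_get.mp hl⟩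
    let P := (SimpleGraph.pathGraph l.length).map ι
    have hιl : ∀ i, ι i ∈ l := fun i => l.get_mem i
    have hPl : ∀ x y, P.Adj x y → x ∈ l ∧ y ∈ l := by
      intro x y hxy
      obtain ⟨i, j, -, rfl, rfl⟩ := (SimpleGraph.map_adj ι _ _ _).mp hxy
      exact ⟨hιl i, hιl j⟩
    have hPG : P ≤ G := by
      intro x y hxy
      obtain ⟨i, j, hij, rfl, rfl⟩ := (SimpleGraph.map_adj ι _ _ _).mp hxy
      have key : ∀ i j : Fin l.length, i.val + 1 = j.val → G.Adj (ι i) (ι j) := by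
        intro i j hij
        have := List.isChain_iff_getElem.mp hc i.val (by omega)
        have hj : ι j = l[i.val + 1]'(by omega) := by
          simp only [hij]
          rfl
        rw [hj]
        exact this
      rcases SimpleGraph.pathGraph_adj.mp hij with h | h
      · exact key i j h
      · exact (key j i h).symm
    have hlS : ∀ x ∈ l, x ∉ S := fun x hx => Set.disjoint_left.mp hd hx
    refine ⟨H ⊔ P, sup_le hHG hPG, ?_, ?_⟩
    · rintro x y (hxy | hxy)
      · exact ⟨Or.inr (hHS x y hxy).1, Or.inr (hHS x y hxy).2⟩
      · exact ⟨Or.inl (hPl x y hxy).1, Or.inl (hPl x y hxy).2⟩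
    · rintro x (hx | hx)
      · have hr : ∀ y, y ∈ Set.range ι ↔ y ∈ l := by
          intro y
          constructor
          · rintro ⟨i, rfl⟩
            exact hιl i
          · intro hy
            obtain ⟨i, hi⟩ := List.get_of_mem hy
            exact ⟨i, hi⟩
        refine ⟨l.length, h3, ⟨ι, ?_⟩, (hr x).mpr hx, ?_⟩
        · intro i j
          rw [SimpleGraph.sup_adj]
          constructor
          · rintro (h | h)
            · exact absurd (hHS _ _ h).1 (hlS _ (hιl i))
            · exact SimpleGraph.map_adj_apply.mp h
          · exact fun h => Or.inr (SimpleGraph.map_adj_apply.mpr h)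
        · rintro y hy z (hyz | hyz)
          · exact absurd (hHS _ _ hyz).1 (hlS _ ((hr y).mp hy))
          · exact (hr z).mpr (hPl _ _ hyz).2
      · obtain ⟨n, hn, φ, hxφ, hφ⟩ := hH x hx
        have hφS : ∀ y ∈ Set.range φ, y ∈ S := by
          rintro _ ⟨i, rfl⟩
          -- As `n ≥ 3`, no path vertex is isolated, and every edge of `H` lies in `S`.
          obtain ⟨j, hj⟩ : ∃ j, (SimpleGraph.pathGraph n).Adj i j := by
            by_cases h0 : i.val = 0
            · exact ⟨⟨1, by omega⟩, SimpleGraph.pathGraph_adj.mpr (Or.inl (by simp [h0]))⟩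
            · exact ⟨⟨i.val - 1, by omega⟩,
                SimpleGraph.pathGraph_adj.mpr (Or.inr (by simp; omega))⟩
          exact (hHS _ _ (φ.map_adj_iff.mpr hj)).1
        refine ⟨n, hn, ⟨φ.toEmbedding, ?_⟩, hxφ, ?_⟩
        · intro i j
          rw [SimpleGraph.sup_adj]
          constructor
          · rintro (h | h)
            · exact φ.map_adj_iff.mp h
            · exact absurd (hφS _ ⟨i, rfl⟩) (hlS _ (hPl _ _ h).1)
          · exact fun h => Or.inl (φ.map_adj_iff.mpr h)
        · rintro y hy z (hyz | hyz)
          · exact hφ y hy z hyz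
          · exact absurd (hφS y hy) (hlS _ (hPl _ _ hyz).1)

theorem PathCover.hasPathFactor {V : Type*} {G : SimpleGraph V} (h : PathCover G Set.univ) :
    HasPathFactor 3 G := by
  obtain ⟨H, hHG, -, hH⟩ := h.exists_le
  refine ⟨H, hHG, fun c => ?_⟩
  obtain ⟨v, rfl⟩ := c.exists_rep
  obtain ⟨n, hn, φ, hvφ, hφ⟩ := hH v trivial
  refine ⟨n, hn, ?_⟩
  have hrange : Set.range (SimpleGraph.Embedding.refl (G := H)) = Set.univ := Set.range_id
  have h1 : IsComp H Set.univ (Set.range φ) := by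
    have h0 : IsComp H (Set.range φ) (Set.range φ) := by
      have hpc : (SimpleGraph.pathGraph n).Preconnected := SimpleGraph.pathGraph_preconnected n
      obtain ⟨i, -⟩ := hvφ
      refine (isComp_range_iff φ).mpr ⟨SimpleGraph.connectedComponentMk _ i, ?_⟩
      rw [← Set.image_univ]
      congr 1
      ext j
      simp only [Set.mem_univ, SimpleGraph.ConnectedComponent.mem_supp_iff, true_iff]
      exact SimpleGraph.ConnectedComponent.sound (hpc j i)
    exact h0.of_closed (Set.subset_univ _) fun x hx y _ hxy => hφ x hx y hxy
  rw [← hrange] at h1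
  obtain ⟨c, hc⟩ := (isComp_range_iff _).mp h1
  have hc' : Set.range φ = c.supp := by
    rw [hc]
    exact Set.image_id _
  have hcv : c = H.connectedComponentMk v := by
    rw [hc', SimpleGraph.ConnectedComponent.mem_supp_iff] at hvφ
    exact hvφ.symm
  subst hcv
  refine exists_iso_of_range_eq (SimpleGraph.Embedding.induce _) φ ?_
  exact (range_induce_embedding H _).trans hc'.symm

theorem IsCorona.exists_addPendants [Finite V] (h : IsCorona G C K f) :
    ∃ (n : ℕ) (H : SimpleGraph (Fin n)), IsFactorCritical H ∧
      ∃ θ : addPendants H ↪g G, Set.range θ = C := by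
  let e : Fin K.ncard ≃ K := (Finite.equivFinOfCardEq (Nat.card_coe_set_eq K)).symm
  have heK : ∀ i, (e i : V) ∈ K := fun i => (e i).2
  have heinj : ∀ i j, (e i : V) = e j → i = j := fun i j h => e.injective (Subtype.ext h)
  let H : SimpleGraph (Fin K.ncard) := G.comap fun i => (e i : V)
  refine ⟨K.ncard, H, ?_, ⟨⟨Sum.elim (fun i => (e i : V)) fun i => f (e i), ?_⟩, ?_⟩, ?_⟩
  · intro v
    obtain ⟨g, hg⟩ := h.critical (e v) (heK v)
    have hmem : ∀ x : ({v}ᶜ : Set (Fin K.ncard)), (e x.1 : V) ∈ K \ {(e v : V)} := fun x =>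
      ⟨heK _, fun hx => x.2 (heinj _ _ hx)⟩
    refine ⟨⟨Set.univ, fun x y => g (e x.1) = e y.1, ?_, by simp, ⟨?_⟩⟩, ?_, ?_⟩
    · intro x y hxy
      change G.Adj (e x.1) (e y.1)
      rw [← hxy]
      exact (hg _ (hmem x)).2.1
    · intro x y hxy
      rw [← hxy]
      exact (hg _ (hmem x)).2.2
    · intro x _
      obtain ⟨h1, -, -⟩ := hg _ (hmem x)
      have h2 : (e (e.symm ⟨g (e x.1), h1.1⟩) : V) = g (e x.1) := by simp
      refine ⟨⟨e.symm ⟨g (e x.1), h1.1⟩, fun hv => h1.2 ?_⟩, h2.symm, ?_⟩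
      · rw [← h2, hv]
        rfl
      · intro y hy
        exact Subtype.ext (heinj _ _ (by rw [h2]; exact (show g (e x.1) = e y.1 from hy).symm))
    · intro x
      trivial
  · rintro (i | i) (j | j) hij
    · rw [heinj _ _ hij]
    · exact absurd hij.symm (h.pendant.ne (heK j) (heK i))
    · exact absurd hij (h.pendant.ne (heK i) (heK j))
    · rw [heinj _ _ (h.pendant.inj (heK i) (heK j) hij)]
  · have hlf : ∀ i j, G.Adj (f (e i)) (e j) ↔ i = j := fun i j =>
      ⟨fun hij => (heinj _ _ (h.leaf _ (heK i) _ (h.subset (heK j)) hij)).symm, by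
        rintro rfl
        exact (h.pendant.adj _ (heK i)).symm⟩
    rintro (i | i) (j | j)
    · exact Iff.rfl
    · exact (G.adj_comm _ _).trans ((hlf j i).trans eq_comm)
    · exact hlf i j
    · refine iff_of_false (fun hij => ?_) (fun h => h)
      exact h.pendant.ne (heK j) (heK i) (h.leaf _ (heK i) _ (h.map_mem (heK j)) hij)
  · ext x
    rw [h.mem_iff]
    constructor
    · rintro ⟨i | i, rfl⟩
      · exact ⟨e i, heK i, Or.inl rfl⟩
      · exact ⟨e i, heK i, Or.inr rfl⟩
    · rintro ⟨k, hk, rfl | rfl⟩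
      · exact ⟨Sum.inl (e.symm ⟨x, hk⟩), congrArg Subtype.val (e.apply_symm_apply ⟨x, hk⟩)⟩
      · exact ⟨Sum.inr (e.symm ⟨k, hk⟩),
          congrArg (fun z : K => f z) (e.apply_symm_apply ⟨k, hk⟩)⟩

theorem IsSunSet.isSun [Finite V] (h : IsSunSet G C) (φ : S ↪g G) (hφ : Set.range φ = C) :
    IsSun S := by
  rcases h with ⟨v, rfl⟩ | ⟨K, f, hK⟩
  · left
    obtain ⟨w, -⟩ : v ∈ Set.range φ := hφ ▸ rfl
    have hv : ∀ x, φ x = v := fun x => by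
      have hx : φ x ∈ Set.range φ := ⟨x, rfl⟩
      rwa [hφ] at hx
    have hs : Subsingleton W := ⟨fun x y => φ.injective ((hv x).trans (hv y).symm)⟩
    have := uniqueOfSubsingleton w
    refine ⟨⟨Equiv.ofUnique W (Fin 1), ?_⟩⟩
    intro x y
    rw [Subsingleton.elim x y]
    simp
  · obtain ⟨n, H, hH, θ, hθ⟩ := hK.exists_addPendants
    exact Or.inr (Or.inr ⟨n, H, hH, exists_iso_of_range_eq φ θ (hφ.trans hθ.symm)⟩)

/-- One inequality suffices, since the toughness bounds `sunNumber` from above; hence only the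
passage from sun sets to suns is needed. -/
theorem ncard_sunSets_le_sunNumber [Finite V] (G : SimpleGraph V) (X : Set V) :
    (sunSets G Xᶜ).ncard ≤ sunNumber (deleteVerts G X) := by
  let φ := SimpleGraph.Embedding.induce (G := G) Xᶜ
  refine (Set.ncard_le_ncard (t := (fun c : (deleteVerts G X).ConnectedComponent => φ '' c.supp) ''
    {c | IsSun c.toSimpleGraph}) ?_).trans (Set.ncard_image_le (Set.toFinite _))
  rintro C ⟨hC, hs⟩
  rw [← range_induce_embedding G Xᶜ] at hC
  obtain ⟨c, rfl⟩ := (isComp_range_iff φ).mp hC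
  refine ⟨c, hs.isSun ((SimpleGraph.Embedding.induce c.supp).trans φ) ?_, rfl⟩
  change Set.range (φ ∘ _) = _
  rw [Set.range_comp]
  exact congrArg (φ '' ·) (range_induce_embedding _ _)

end Translation

/-! ### Connectivity, toughness, and the sun bound after deleting edges. -/

section Deleted

variable {V : Type*} {G : SimpleGraph V} {C D X U : Set V} {v : V} {m : ℕ}

theorem eq_of_isComp_top (hC : IsComp (⊤ : SimpleGraph V) U C) (hD : IsComp ⊤ U D) : C = D := by
  obtain ⟨x, hx⟩ := hC.nonempty
  obtain ⟨y, hy⟩ := hD.nonempty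
  by_cases hxy : x = y
  · exact hC.eq_of_mem hD hx (hxy ▸ hy)
  · exact hC.eq_of_mem hD (hC.closed x hx y (hD.subset hy) hxy) hy

/-- Deleting fewer than `κ(G)` vertices leaves at most one component. -/
theorem eq_of_isComp_of_lt_connectivity (hX : X.ncard < connectivity G) (hC : IsComp G Xᶜ C)
    (hD : IsComp G Xᶜ D) : C = D := by
  by_cases hG : G = ⊤
  · subst hG
    exact eq_of_isComp_top hC hD
  · rw [connectivity, if_neg hG] at hX
    have hcut : ¬ IsVertexCut G X := fun h => hX.not_ge (Nat.sInf_le ⟨X, h, rfl⟩)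
    rw [IsVertexCut, not_not] at hcut
    rw [← range_induce_embedding G Xᶜ] at hC hD
    obtain ⟨c, rfl⟩ := (isComp_range_iff _).mp hC
    obtain ⟨d, rfl⟩ := (isComp_range_iff _).mp hD
    have : c = d := by
      induction c using SimpleGraph.ConnectedComponent.ind with
      | h v =>
        induction d using SimpleGraph.ConnectedComponent.ind with
        | h w => exact SimpleGraph.ConnectedComponent.sound (hcut v w)
    rw [this]

variable [Finite V]

/-- In the non-complete case, deleting all but two non-adjacent vertices disconnects the graph. -/
theorem connectivity_lt_card (h : 0 < connectivity G) : connectivity G < Nat.card V := by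
  by_cases hG : G = ⊤
  · rw [connectivity, if_pos hG] at h ⊢
    omega
  · by_contra hle
    obtain ⟨u, v, huv, hadj⟩ : ∃ u v, u ≠ v ∧ ¬ G.Adj u v := by
      by_contra! hc
      exact hG (by ext u v; exact ⟨fun h => h.ne, hc u v⟩)
    have hX : ({u, v}ᶜ : Set V).ncard < connectivity G := by
      have h1 := Set.ncard_add_ncard_compl {u, v}
      rw [Set.ncard_pair huv] at h1
      omega
    have hmem : ∀ y ∈ ({u, v}ᶜᶜ : Set V), y = u ∨ y = v := fun y hy => by simpa using hy
    have h1 : IsComp G {u, v}ᶜᶜ {u} := isComp_singleton (by simp) fun y hy huy => by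
      rcases hmem y hy with rfl | rfl
      exacts [huy.ne rfl, hadj huy]
    have h2 : IsComp G {u, v}ᶜᶜ {v} := isComp_singleton (by simp) fun y hy hvy => by
      rcases hmem y hy with rfl | rfl
      exacts [hadj hvy.symm, hvy.ne rfl]
    exact huv (Set.singleton_injective (eq_of_isComp_of_lt_connectivity hX h1 h2))

/-- Deleting the neighbours of `v` isolates it. If they were too few to be a cut, they and `v` would
be all vertices, too few by `connectivity_lt_card`. -/
theorem connectivity_le_ncard_neighborSet (G : SimpleGraph V) (v : V) :
    connectivity G ≤ (G.neighborSet v).ncard := by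
  by_contra! hlt
  have hcard := connectivity_lt_card (G := G) (by omega)
  have h1 : IsComp G (G.neighborSet v)ᶜ {v} :=
    isComp_singleton (by simp) fun y hy hvy => hy hvy
  obtain ⟨u, hu⟩ : ∃ u, u ∉ insert v (G.neighborSet v) := by
    by_contra! hc
    have h2 := Set.ncard_insert_le v (G.neighborSet v)
    rw [Set.eq_univ_of_forall hc, Set.ncard_univ] at h2
    omega
  rw [Set.mem_insert_iff, not_or] at hu
  obtain ⟨D, hD, huD⟩ := exists_isComp_mem G (show u ∈ (G.neighborSet v)ᶜ from hu.2)
  rw [← eq_of_isComp_of_lt_connectivity hlt h1 hD] at huD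
  exact hu.1 huD

theorem mul_ncard_sunSets_le
    (hsun : ((m : ENNReal) + 1) / ((m : ENNReal) + 2) ≤ sunToughness G)
    (hX : 2 ≤ (sunSets G Xᶜ).ncard) : (m + 1) * (sunSets G Xᶜ).ncard ≤ (m + 2) * X.ncard := by
  by_cases hG : G = ⊤
  · subst hG
    obtain ⟨C, hC, D, hD, hne⟩ := (Set.one_lt_ncard).mp (show 1 < (sunSets ⊤ Xᶜ).ncard by omega)
    exact absurd (eq_of_isComp_top hC.1 hD.1) hne
  · have hle := ncard_sunSets_le_sunNumber G X
    set s := sunNumber (deleteVerts G X)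
    have h1 : ((m : ENNReal) + 1) / ((m : ENNReal) + 2) ≤ (X.ncard : ENNReal) / s := by
      refine hsun.trans ?_
      rw [sunToughness, if_neg hG]
      exact sInf_le ⟨X, by omega, rfl⟩
    have hs : (s : ENNReal) ≠ 0 := by
      rw [Nat.cast_ne_zero]
      omega
    rw [ENNReal.div_le_iff (by simp) (by finiteness), ← ENNReal.mul_div_right_comm,
      ENNReal.le_div_iff_mul_le (Or.inl hs) (Or.inl (ENNReal.natCast_ne_top s))] at h1
    have h2 : (m + 1) * s ≤ X.ncard * (m + 2) := by exact_mod_cast h1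
    rw [mul_comm (m + 2)]
    exact (Nat.mul_le_mul_left _ hle).trans h2

theorem ncard_sunSets_deleteEdges_le (G : SimpleGraph V) (U : Set V) (E : Set (Sym2 V)) :
    (sunSets (G.deleteEdges E) U).ncard ≤ (sunSets G U).ncard + 2 * E.ncard := by
  induction E, E.toFinite using Set.Finite.induction_on with
  | empty => simp
  | @insert e E he _ ih =>
    have h1 : G.deleteEdges (insert e E) = (G.deleteEdges E).deleteEdges {e} := by
      rw [SimpleGraph.deleteEdges_deleteEdges, Set.union_singleton]
    rw [h1, Set.ncard_insert_of_notMem he]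
    induction e using Sym2.ind with
    | _ w a =>
      have := ncard_sunSets_deleteEdge_le (G.deleteEdges E) U w a
      omega

/-- A sun component left by `X` has a vertex with at most one neighbour outside `X`. -/
theorem exists_ncard_neighborSet_le (hC : C ∈ sunSets G Xᶜ) :
    ∃ u ∈ C, (G.neighborSet u).ncard ≤ X.ncard + 1 := by
  have key : ∀ u ∈ C, ∀ k, (∀ y ∈ C, G.Adj u y → y = k) →
      (G.neighborSet u).ncard ≤ X.ncard + 1 := by
    intro u hu k hk
    refine (Set.ncard_le_ncard (t := insert k X) fun y hy => ?_).trans (Set.ncard_insert_le k X)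
    by_cases hyX : y ∈ X
    · exact Or.inr hyX
    · exact Or.inl (hk y (hC.1.closed u hu y hyX hy) hy)
  rcases hC with ⟨-, ⟨v, rfl⟩ | ⟨K, f, hK⟩⟩
  · exact ⟨v, rfl, key v rfl v fun y hy _ => hy⟩
  · obtain ⟨k, hk⟩ := hK.nonempty
    exact ⟨f k, hK.map_mem hk, key _ (hK.map_mem hk) k (hK.leaf k hk)⟩

theorem ncard_neighborSet_le_add (G : SimpleGraph V) (E : Set (Sym2 V)) (u : V) :
    (G.neighborSet u).ncard ≤
      ((G.deleteEdges E).neighborSet u).ncard + {e ∈ E | u ∈ e}.ncard := by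
  have h1 : G.neighborSet u ⊆ (G.deleteEdges E).neighborSet u ∪ {y | s(u, y) ∈ E} := by
    intro y hy
    by_cases hE : s(u, y) ∈ E
    · exact Or.inr hE
    · exact Or.inl (SimpleGraph.deleteEdges_adj.mpr ⟨hy, hE⟩)
  refine (Set.ncard_le_ncard h1).trans ((Set.ncard_union_le _ _).trans ?_)
  refine Nat.add_le_add_left (Set.ncard_le_ncard_of_injOn (fun y => s(u, y)) ?_ ?_) _
  · exact fun y hy => ⟨hy, Sym2.mem_mk_left u y⟩
  · intro y _ z _ h
    exact Sym2.congr_right.mp h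

theorem sunBound_deleteEdges (hm : 1 ≤ m) (hconn : 2 * m + 1 ≤ connectivity G)
    (hsun : ((m : ENNReal) + 1) / ((m : ENNReal) + 2) ≤ sunToughness G) {E : Set (Sym2 V)}
    (hE : E.ncard = m) : SunBound (G.deleteEdges E) Set.univ := by
  intro X _
  rw [← Set.compl_eq_univ_sdiff]
  by_contra! hlt
  have hdeg : ∀ C ∈ sunSets (G.deleteEdges E) Xᶜ,
      ∃ u ∈ C, 2 * m ≤ X.ncard + {e ∈ E | u ∈ e}.ncard := by
    intro C hC
    obtain ⟨u, hu, hle⟩ := exists_ncard_neighborSet_le hC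
    have h1 := connectivity_le_ncard_neighborSet G u
    have h2 := ncard_neighborSet_le_add G E u
    exact ⟨u, hu, by omega⟩
  have hEu : ∀ u, {e ∈ E | u ∈ e}.ncard ≤ m := fun u =>
    hE ▸ Set.ncard_le_ncard fun e he => he.1
  rcases lt_trichotomy X.ncard m with hXm | hXm | hXm
  · obtain ⟨C, hC⟩ := (Set.ncard_pos).mp
      (show 0 < (sunSets (G.deleteEdges E) Xᶜ).ncard by omega)
    obtain ⟨u, -, hu⟩ := hdeg C hC
    have := hEu u
    omega
  -- Each chosen vertex now meets all `m` edges of `E`, but a single edge cannot have ends in three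
  -- disjoint suns.
  · obtain ⟨A, B, C, hA, hB, hC, hAB, hAC, hBC⟩ := (Set.two_lt_ncard_iff).mp
      (show 2 < (sunSets (G.deleteEdges E) Xᶜ).ncard by omega)
    obtain ⟨e, he⟩ := (Set.ncard_pos).mp (show 0 < E.ncard by omega)
    have hall : ∀ C ∈ sunSets (G.deleteEdges E) Xᶜ, ∃ u ∈ C, u ∈ e := by
      intro C hC
      obtain ⟨u, hu, hle⟩ := hdeg C hC
      have h1 : {e ∈ E | u ∈ e} = E :=
        Set.eq_of_subset_of_ncard_le (fun e he => he.1) (by omega)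
      exact ⟨u, hu, (h1.symm ▸ he : e ∈ {e ∈ E | u ∈ e}).2⟩
    obtain ⟨a, ha, hae⟩ := hall A hA
    obtain ⟨b, hb, hbe⟩ := hall B hB
    obtain ⟨c, hc, hce⟩ := hall C hC
    have hab : a ≠ b := fun h => hAB (hA.1.eq_of_mem hB.1 ha (h ▸ hb))
    have hac : a ≠ c := fun h => hAC (hA.1.eq_of_mem hC.1 ha (h ▸ hc))
    have hbc : b ≠ c := fun h => hBC (hB.1.eq_of_mem hC.1 hb (h ▸ hc))
    rw [(Sym2.mem_and_mem_iff hab).mp ⟨hae, hbe⟩, Sym2.mem_iff] at hce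
    exact hce.elim (fun h => hac h.symm) fun h => hbc h.symm
  · have h1 := ncard_sunSets_deleteEdges_le G Xᶜ E
    rw [hE] at h1
    by_cases hXm2 : X.ncard ≤ 2 * m
    · have h2 : (sunSets G Xᶜ).ncard ≤ 1 := by
        refine (Set.ncard_le_one).mpr fun C hC D hD => ?_
        exact eq_of_isComp_of_lt_connectivity (by omega) hC.1 hD.1
      omega
    · have h2 := mul_ncard_sunSets_le (X := X) hsun (by omega)
      have h3 : 2 * X.ncard + 1 ≤ (sunSets G Xᶜ).ncard + 2 * m := by omega
      have h4 : 2 * m + 1 ≤ X.ncard := by omega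
      -- Combining `h2` and `h3` gives `m|X| ≤ 2m² + m - 1`, while `h4` gives `m|X| ≥ 2m² + m`.
      nlinarith [Nat.mul_le_mul_left (m + 1) h3, Nat.mul_le_mul_left m h4]

end Deleted

end PathFactor

theorem theorem4 {V : Type*} [Finite V] (G : SimpleGraph V) (m : ℕ) (hm : 1 ≤ m)
    (hconn : 2 * m + 1 ≤ PathFactor.connectivity G)
    (hsun : ((m : ENNReal) + 1) / ((m : ENNReal) + 2) ≤ PathFactor.sunToughness G) :
    PathFactor.IsPathFactorDeleted 3 m G := by
  intro E' _ hE'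
  exact (PathFactor.sunBound_deleteEdges hm hconn hsun hE').pathCover.hasPathFactor
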